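/- Let $(X,d)$ be a complete metric space with at least two points, equipped with a Borel regular outer measure $\mu$ that is doubling, i.e. there is $C_d\ge 1$ with $0<\mu(B(x,2r))\le C_d\,\mu(B(x,r))<\infty$ for all $x\in X$, $r>0$, and that supports a $(1,1)$-Poincaré inequality, i.e. there are $C_P>0$ and $\lambda\ge 1$ such that for every ball $B(x,r)$, every locally integrable function $u$ on $X$ and every upper gradient $g$ of $u$, $$\frac1{\mu(B(x,r))}\int_{B(x,r)}|u-u_{B(x,r)}|\,d\mu\le C_P\,r\,\frac1{\mu(B(x,\lambda r))}\int_{B(x,\lambda r)}g\,d\mu ,$$ where $u_{B(x,r)}$ is the mean value of $u$ over $B(x,r)$. Here a curve is a rectifiable continuous map from a compact interval into $X$. A Borel function $g\colon X\to[0,\infty]$ is an upper gradient of $u$ if $|u(x)-u(y)|\le\int_\gamma g\,ds$ for every curve $\gamma$, where $x,y$ are the end points of $\gamma$. For $U\subset X$ open, a $\mu$-measurable $g\colon U\to[0,\infty]$ is a $1$-weak upper gradient of $u$ in $U$ if this inequality holds for all curves $\gamma$ in $U$ outside a family $\Gamma$ of $1$-modulus zero, that is, $\inf\int_X\rho\,d\mu=0$,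 the infimum being taken over all Borel $\rho\colon X\to[0,\infty]$ with $\int_\gamma\rho\,ds\ge1$ for all $\gamma\in\Gamma$. The minimal $1$-weak upper gradient of $u$ in $U$ is the ($\mu$-a.e. unique) $1$-weak upper gradient $g_u\in L^1_{\mathrm{loc}}(U)$ of $u$ in $U$ such that $g_u\le g$ $\mu$-a.e. in $U$ for every $1$-weak upper gradient $g\in L^1_{\mathrm{loc}}(U)$ of $u$ in $U$. $\mathrm{Lip}_{\mathrm{loc}}(U)$ and $L^1_{\mathrm{loc}}(U)$ consist of the functions that are Lipschitz, respectively integrable, in every open $V$ whose closure is a compact subset of $U$. For open sets $\Omega,U\subset X$ let $$P_+(\Omega,U):=\inf\Big\{\liminf_{i\to\infty}\int_U g_{\Psi_i}\,d\mu\Big\},$$ where $g_{\Psi_i}$ is the minimal $1$-weak upper gradient of $\Psi_i$ in $U$ and the infimum is taken over all sequences $(\Psi_i)\subset\mathrm{Lip}_{\mathrm{loc}}(U)$ with $\Psi_i-\chi_\Omega\to0$ in $L^1(U)$ and $\Psi_i=0$ in $U\setminus\Omega$ for each $i$. For an arbitrary $A\subset X$ let $$P_+(\Omega,A):=\inf\{P_+(\Omega,U):\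 U\text{ open},\ A\subset U\}.$$ Theorem. Let $\Omega\subset X$ be an open set with $P_+(\Omega,X)<\infty$. Then $A\mapsto P_+(\Omega,A)$ is a Borel regular outer measure on $X$: it is an outer measure, all Borel sets are Carathéodory measurable for it, and every $A\subset X$ is contained in a Borel set $B$ with $P_+(\Omega,B)=P_+(\Omega,A)$. Moreover it is a Radon measure: it is finite on compact sets, $P_+(\Omega,A)=\inf\{P_+(\Omega,U): U\supset A\text{ open}\}$ for all $A\subset X$, and $P_+(\Omega,U)=\sup\{P_+(\Omega,K): K\subset U\text{ compact}\}$ for all open $U\subset X$. -/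

import Mathlib

open MeasureTheory Set Filter Topology
open scoped ENNReal NNReal

noncomputable section

namespace InnerPerimeter

/-! ### Curves, upper gradients, and the minimal 1-weak upper gradient -/

section Curves

variable {X : Type*} [MetricSpace X]

/-- A curve: a rectifiable continuous map from a compact interval `[a, b]` into `X`.
(The values of `toFun` outside `[a, b]` play no role.) -/
structure Curve (X : Type*) [MetricSpace X] where
  a : ℝ
  b : ℝ
  a_le_b : a ≤ b
  toFun : ℝ → X
  continuousOn : ContinuousOn toFun (Icc a b)
  rectifiable : eVariationOn toFun (Icc a b) ≠ ∞

/-- The length of a curve. -/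
def Curve.length (γ : Curve X) : ℝ := (eVariationOn γ.toFun (Icc γ.a γ.b)).toReal

/-- The trace of a curve. -/
def Curve.image (γ : Curve X) : Set X := γ.toFun '' Icc γ.a γ.b

/-- The initial point of a curve. -/
def Curve.source (γ : Curve X) : X := γ.toFun γ.a

/-- The terminal point of a curve. -/
def Curve.target (γ : Curve X) : X := γ.toFun γ.b

/-- The arc-length parametrization of a curve, to be used on `[0, length γ]`. -/
def Curve.arcLengthParam (γ : Curve X) : ℝ → X :=
  naturalParameterization γ.toFun (Icc γ.a γ.b) γ.a

/-- The path integral `∫_γ g ds`, computed in the arc-length parametrization. -/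
def Curve.integral (γ : Curve X) (g : X → ℝ≥0∞) : ℝ≥0∞ :=
  ∫⁻ t in Icc 0 γ.length, g (γ.arcLengthParam t)

/-- The inequality `|u(x) - u(y)| ≤ ∫_γ g ds`, where `x`, `y` are the end points of `γ`. -/
def UpperGradientIneq (u : X → ℝ) (g : X → ℝ≥0∞) (γ : Curve X) : Prop :=
  edist (u γ.source) (u γ.target) ≤ γ.integral g

variable [MeasurableSpace X]

/-- `g` is an upper gradient of `u` on `X`. -/
def IsUpperGradient (u : X → ℝ) (g : X → ℝ≥0∞) : Prop :=
  Measurable g ∧ ∀ γ : Curve X, UpperGradientIneq u g γ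

/-- The `1`-modulus of a family of curves. -/
def modulus (μ : Measure X) (Γ : Set (Curve X)) : ℝ≥0∞ :=
  ⨅ (ρ : X → ℝ≥0∞) (_ : Measurable ρ) (_ : ∀ γ ∈ Γ, 1 ≤ γ.integral ρ), ∫⁻ x, ρ x ∂μ

/-- `g` is a `1`-weak upper gradient of `u` in `U`: it is `μ`-measurable on `U`, and the upper
gradient inequality holds for `1`-almost every curve in `U`. -/
def IsWeakUpperGradient (μ : Measure X) (U : Set X) (u : X → ℝ) (g : X → ℝ≥0∞) : Prop :=
  AEMeasurable g (μ.restrict U) ∧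
    modulus μ {γ : Curve X | γ.image ⊆ U ∧ ¬ UpperGradientIneq u g γ} = 0

/-- `V ⋐ U`: `V` is open and its closure is a compact subset of `U`. -/
def CompactlyContained (V U : Set X) : Prop :=
  IsOpen V ∧ IsCompact (closure V) ∧ closure V ⊆ U

/-- Membership of a (measurable) function `g : X → [0, ∞]` in `L¹_loc(U)`. -/
def LocallyIntegrableIn (μ : Measure X) (U : Set X) (g : X → ℝ≥0∞) : Prop :=
  ∀ V : Set X, CompactlyContained V U → ∫⁻ x in V, g x ∂μ < ∞

/-- `g` is the minimal `1`-weak upper gradient of `u` in `U` (it is unique up to `μ`-null sets). -/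
structure IsMinimalWeakUpperGradient (μ : Measure X) (U : Set X) (u : X → ℝ)
    (g : X → ℝ≥0∞) : Prop where
  isWeakUpperGradient : IsWeakUpperGradient μ U u g
  locallyIntegrableIn : LocallyIntegrableIn μ U g
  minimal : ∀ h : X → ℝ≥0∞, IsWeakUpperGradient μ U u h → LocallyIntegrableIn μ U h →
    ∀ᵐ x ∂(μ.restrict U), g x ≤ h x

/-! ### The standing assumptions on the space -/

/-- The measure `μ` is doubling. -/
def IsDoubling (μ : Measure X) : Prop :=
  ∃ C : ℝ≥0, 1 ≤ C ∧ ∀ (x : X) (r : ℝ), 0 < r →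
    0 < μ (Metric.ball x (2 * r)) ∧
    μ (Metric.ball x (2 * r)) ≤ C * μ (Metric.ball x r) ∧
    μ (Metric.ball x r) < ∞

/-- The space supports a `(1,1)`-Poincaré inequality. -/
def SupportsPoincare (μ : Measure X) : Prop :=
  ∃ C L : ℝ, 0 < C ∧ 1 ≤ L ∧ ∀ (x : X) (r : ℝ), 0 < r →
    ∀ (u : X → ℝ) (g : X → ℝ≥0∞), LocallyIntegrable u μ → IsUpperGradient u g →
      ⨍⁻ y in Metric.ball x r, ‖u y - ⨍ z in Metric.ball x r, u z ∂μ‖ₑ ∂μ ≤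
        ENNReal.ofReal (C * r) * ⨍⁻ y in Metric.ball x (L * r), g y ∂μ

/-! ### The inner perimeter -/

/-- `u ∈ Lip_loc(U)`: `u` is Lipschitz in every `V ⋐ U`. -/
def IsLipLoc (U : Set X) (u : X → ℝ) : Prop :=
  ∀ V : Set X, CompactlyContained V U → ∃ K : ℝ≥0, LipschitzOnWith K u V

/-- The sequences admissible for `P₊(Ω, U)`: `Ψ i ∈ Lip_loc(U)`, `Ψ i = 0` in `U \ Ω`, and
`Ψ i - χ_Ω → 0` in `L¹(U)`. -/
structure IsAdmissible (μ : Measure X) (Ω U : Set X) (Ψ : ℕ → X → ℝ) : Prop where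
  lipLoc : ∀ i, IsLipLoc U (Ψ i)
  eq_zero : ∀ i, ∀ x ∈ U \ Ω, Ψ i x = 0
  tendsto : Tendsto (fun i => ∫⁻ x in U, ‖Ψ i x - Ω.indicator (fun _ => (1 : ℝ)) x‖ₑ ∂μ)
    atTop (𝓝 0)

/-- `P₊(Ω, U)` for open `U`: the infimum of `liminf ∫_U g_{Ψ i} dμ` over the admissible sequences,
`g_{Ψ i}` being the minimal `1`-weak upper gradient of `Ψ i` in `U`. -/
def innerPerimeterOpen (μ : Measure X) (Ω U : Set X) : ℝ≥0∞ :=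
  ⨅ (Ψ : ℕ → X → ℝ) (g : ℕ → X → ℝ≥0∞) (_ : IsAdmissible μ Ω U Ψ)
    (_ : ∀ i, IsMinimalWeakUpperGradient μ U (Ψ i) (g i)),
    liminf (fun i => ∫⁻ x in U, g i x ∂μ) atTop

/-- `P₊(Ω, A)` for an arbitrary set `A`. -/
def innerPerimeter (μ : Measure X) (Ω A : Set X) : ℝ≥0∞ :=
  ⨅ (U : Set X) (_ : IsOpen U) (_ : A ⊆ U), innerPerimeterOpen μ Ω U

end Curves

/-! ### Borel regular outer measures and Radon measures -/

/-- A Borel regular outer measure: Borel sets are Carathéodory measurable, and every set is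
contained in a Borel set of the same measure. -/
structure IsBorelRegular {X : Type*} [TopologicalSpace X] (ν : OuterMeasure X) : Prop where
  borel_le : borel X ≤ ν.caratheodory
  exists_borel : ∀ A : Set X, ∃ B : Set X, MeasurableSet[borel X] B ∧ A ⊆ B ∧ ν B = ν A

/-- A Radon measure, as an outer measure: Borel regular, finite on compact sets, outer regular on
all sets, inner regular on open sets. -/
structure IsRadon {X : Type*} [TopologicalSpace X] (ν : OuterMeasure X) : Prop extends
    IsBorelRegular ν where
  compact_lt_top : ∀ K : Set X, IsCompact K → ν K < ∞
  outer_regular : ∀ A : Set X, ν A = ⨅ (U : Set X) (_ : IsOpen U) (_ : A ⊆ U), ν U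
  inner_regular : ∀ U : Set X, IsOpen U → ν U = ⨆ (K : Set X) (_ : IsCompact K) (_ : K ⊆ U), ν K

end InnerPerimeter

end

noncomputable section

namespace InnerPerimeter

section UnitSpeedCurves

variable {X : Type*} [MetricSpace X]

/-! ### Unit-speed curves -/

/-! The argument is of De Giorgi–Letta type: on open sets the inner perimeter is shown to be
monotone, superadditive on disjoint sets, countably subadditive and determined by compactly
contained open subsets; the outer measure it induces is then metric, and finiteness gives the Radon
properties.

To avoid restricting minimal weak upper gradients from one open set to another, the upper gradient
inequality is replaced by a pointwise one: along almost every curve, `|(u ∘ σ)'| ≤ g ∘ σ` at almost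
every time spent in `U`. For locally Lipschitz `u` and locally integrable, measurable `g` the two
notions agree, and the pointwise one is visibly local and stable under countable infima. So minimal
gradients exist once `energy` is finite, and the inner perimeter can be computed from `energy`.

The main step is `innerPerimeterOpen_le_tsum_of_partition`. If the `φ i` form a Lipschitz partition
of unity and each `u i` is nearly optimal in `W i`, then `∑ φ i * u i` is a competitor in `U`. Since
the derivatives of the `φ i` sum to zero along curves, its gradient is at most the sum over `i` of
`g i + L i * |u i - χ_Ω|` on `W i`, and the second term is made small by taking `u i` close to `χ_Ω`
in `L¹(W i)`. A telescoping partition along an exhaustion gives `innerPerimeterOpen_le_iSup`; a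
two-set partition gives finite subadditivity; compactness then gives countable subadditivity. The
exhaustions require closed balls to be compact, which follows from doubling and completeness. -/

theorem lipschitzOnWith_of_hasUnitSpeedOn {σ : ℝ → X} {a b : ℝ} (h : HasUnitSpeedOn σ (Icc a b)) :
    LipschitzOnWith 1 σ (Icc a b) := by
  have key : ∀ s ∈ Icc a b, ∀ t ∈ Icc a b, s ≤ t → edist (σ s) (σ t) ≤ edist s t := by
    intro s hs t ht hst
    calc edist (σ s) (σ t) ≤ eVariationOn σ (Icc a b ∩ Icc s t) :=
          eVariationOn.edist_le σ ⟨hs, le_rfl, hst⟩ ⟨ht, hst, le_rfl⟩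
      _ = ENNReal.ofReal (t - s) := by simpa using h hs ht
      _ = edist s t := by
          rw [edist_comm, edist_dist, Real.dist_eq, abs_of_nonneg (by linarith)]
  intro s hs t ht
  rw [ENNReal.coe_one, one_mul]
  rcases le_total s t with hst | hst
  · exact key s hs t ht hst
  · rw [edist_comm, edist_comm s]
    exact key t ht s hs hst

theorem hasUnitSpeedOn_mono {σ : ℝ → X} {a b s t : ℝ} (h : HasUnitSpeedOn σ (Icc a b))
    (hs : a ≤ s) (ht : t ≤ b) : HasUnitSpeedOn σ (Icc s t) := by
  intro x hx y hy
  have hsub : Icc s t ⊆ Icc a b := Icc_subset_Icc hs ht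
  rw [← h (hsub hx) (hsub hy)]
  congr 1
  ext z
  simp only [mem_inter_iff, mem_Icc] at *
  constructor
  · rintro ⟨_, h3, h4⟩
    exact ⟨⟨by linarith [hx.1], by linarith [hy.2]⟩, h3, h4⟩
  · rintro ⟨_, h3, h4⟩
    exact ⟨⟨by linarith [hx.1], by linarith [hy.2]⟩, h3, h4⟩

namespace Curve

theorem locallyBoundedVariationOn (γ : Curve X) :
    LocallyBoundedVariationOn γ.toFun (Icc γ.a γ.b) :=
  BoundedVariationOn.locallyBoundedVariationOn γ.rectifiable

theorem length_nonneg (γ : Curve X) : 0 ≤ γ.length := ENNReal.toReal_nonneg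

theorem variationOnFromTo_right (γ : Curve X) :
    variationOnFromTo γ.toFun (Icc γ.a γ.b) γ.a γ.b = γ.length := by
  rw [variationOnFromTo.eq_of_le _ _ γ.a_le_b, inter_self]
  rfl

/-- The one-sided limits of the variation function differ from its value by the jump of the curve,
which is zero by continuity. -/
theorem continuousOn_variationOnFromTo (γ : Curve X) :
    ContinuousOn (variationOnFromTo γ.toFun (Icc γ.a γ.b) γ.a) (Icc γ.a γ.b) := by
  intro t ht
  have ha : γ.a ∈ Icc γ.a γ.b := left_mem_Icc.2 γ.a_le_b
  have hc := γ.continuousOn t ht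
  have hl := variationOnFromTo.tendsto_left ha ht γ.locallyBoundedVariationOn
    (hc.mono_left (nhdsWithin_mono _ inter_subset_left))
  have hr := variationOnFromTo.tendsto_right ha ht γ.locallyBoundedVariationOn
    (hc.mono_left (nhdsWithin_mono _ inter_subset_left))
  rw [dist_self, sub_zero] at hl
  rw [dist_self, add_zero] at hr
  have hs : Icc γ.a γ.b = (Icc γ.a γ.b ∩ Iio t) ∪ {t} ∪ (Icc γ.a γ.b ∩ Ioi t) := by
    ext x
    simp only [mem_union, mem_inter_iff, mem_Iio, mem_Ioi, mem_singleton_iff]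
    constructor
    · intro hx
      rcases lt_trichotomy x t with h | h | h <;> simp [hx, h]
    · rintro ((h | rfl) | h)
      exacts [h.1, ht, h.1]
  unfold ContinuousWithinAt
  conv => enter [2]; rw [hs]
  rw [nhdsWithin_union, nhdsWithin_union, nhdsWithin_singleton]
  exact (hl.sup (tendsto_pure_nhds _ _)).sup hr

/-- The intermediate value theorem excludes gaps, so the natural parametrization has unit speed on a
full interval. -/
theorem image_variationOnFromTo (γ : Curve X) :
    variationOnFromTo γ.toFun (Icc γ.a γ.b) γ.a '' Icc γ.a γ.b = Icc 0 γ.length := by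
  have ha : γ.a ∈ Icc γ.a γ.b := left_mem_Icc.2 γ.a_le_b
  have hb : γ.b ∈ Icc γ.a γ.b := right_mem_Icc.2 γ.a_le_b
  have hm := variationOnFromTo.monotoneOn γ.locallyBoundedVariationOn ha
  apply Subset.antisymm
  · rintro _ ⟨t, ht, rfl⟩
    refine ⟨variationOnFromTo.nonneg_of_le _ _ ht.1, ?_⟩
    rw [← γ.variationOnFromTo_right]
    exact hm ht hb ht.2
  · have := intermediate_value_Icc γ.a_le_b γ.continuousOn_variationOnFromTo
    rwa [variationOnFromTo.self, γ.variationOnFromTo_right] at this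

theorem hasUnitSpeedOn_arcLengthParam (γ : Curve X) :
    HasUnitSpeedOn γ.arcLengthParam (Icc 0 γ.length) := by
  rw [← γ.image_variationOnFromTo]
  exact has_unit_speed_naturalParameterization _ γ.locallyBoundedVariationOn
    (left_mem_Icc.2 γ.a_le_b)

theorem arcLengthParam_variationOnFromTo (γ : Curve X) {t : ℝ} (ht : t ∈ Icc γ.a γ.b) :
    γ.arcLengthParam (variationOnFromTo γ.toFun (Icc γ.a γ.b) γ.a t) = γ.toFun t :=
  edist_eq_zero.1 (edist_naturalParameterization_eq_zero γ.locallyBoundedVariationOn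
    (left_mem_Icc.2 γ.a_le_b) ht)

theorem arcLengthParam_zero (γ : Curve X) : γ.arcLengthParam 0 = γ.source := by
  have h := γ.arcLengthParam_variationOnFromTo (left_mem_Icc.2 γ.a_le_b)
  rwa [variationOnFromTo.self] at h

theorem arcLengthParam_length (γ : Curve X) : γ.arcLengthParam γ.length = γ.target := by
  have h := γ.arcLengthParam_variationOnFromTo (right_mem_Icc.2 γ.a_le_b)
  rwa [variationOnFromTo_right] at h

theorem arcLengthParam_mem_image (γ : Curve X) {t : ℝ} (ht : t ∈ Icc 0 γ.length) :
    γ.arcLengthParam t ∈ γ.image := by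
  rw [← γ.image_variationOnFromTo] at ht
  obtain ⟨s, hs, rfl⟩ := ht
  rw [γ.arcLengthParam_variationOnFromTo hs]
  exact ⟨s, hs, rfl⟩

/-- A unit-speed map on a compact interval, as a curve. -/
def ofUnitSpeed (σ : ℝ → X) (a b : ℝ) (hab : a ≤ b) (h : HasUnitSpeedOn σ (Icc a b)) : Curve X where
  a := a
  b := b
  a_le_b := hab
  toFun := σ
  continuousOn := (lipschitzOnWith_of_hasUnitSpeedOn h).continuousOn
  rectifiable := by
    have := h (left_mem_Icc.2 hab) (right_mem_Icc.2 hab)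
    rw [inter_self] at this
    rw [this]
    exact ENNReal.ofReal_ne_top

/-- At unit speed the arc-length parameter is `t - a`, so only a translation of the variable
separates the two integrals. -/
theorem integral_ofUnitSpeed {σ : ℝ → X} {a b : ℝ} (hab : a ≤ b)
    (h : HasUnitSpeedOn σ (Icc a b)) (g : X → ℝ≥0∞) :
    (ofUnitSpeed σ a b hab h).integral g = ∫⁻ t in Icc a b, g (σ t) := by
  set γ := ofUnitSpeed σ a b hab h
  have hv : ∀ t ∈ Icc a b, variationOnFromTo σ (Icc a b) a t = t - a := by
    intro t ht
    rw [variationOnFromTo.eq_of_le _ _ ht.1, h (left_mem_Icc.2 hab) ht]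
    simp [ht.1]
  have hlen : γ.length = b - a := by
    rw [← γ.variationOnFromTo_right]
    exact hv b (right_mem_Icc.2 hab)
  have hpar : ∀ t ∈ Icc a b, γ.arcLengthParam (t - a) = σ t := by
    intro t ht
    rw [← hv t ht]
    exact γ.arcLengthParam_variationOnFromTo ht
  have hmp : MeasurePreserving (fun t : ℝ => t - a) volume volume :=
    measurePreserving_sub_right volume a
  have hemb : MeasurableEmbedding (fun t : ℝ => t - a) :=
    (MeasurableEquiv.subRight a).measurableEmbedding
  unfold integral
  rw [hlen, ← hmp.setLIntegral_comp_preimage_emb hemb]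
  have hpre : (fun t : ℝ => t - a) ⁻¹' Icc 0 (b - a) = Icc a b := by
    ext t
    simp
  rw [hpre]
  refine setLIntegral_congr_fun measurableSet_Icc fun t ht => ?_
  simp only [hpar t ht]

end Curve

/-! ### Modulus and properties of almost every curve -/

variable [MeasurableSpace X]

/-- A property of unit-speed maps `σ` on `[a, b]` holds along almost every curve if it holds
whenever `∫ ρ ∘ σ < ∞`, for some fixed Borel function `ρ` of finite integral. -/
def AlongAECurve (μ : Measure X) (p : ℝ → ℝ → (ℝ → X) → Prop) : Prop :=
  ∃ ρ : X → ℝ≥0∞, Measurable ρ ∧ ∫⁻ x, ρ x ∂μ ≠ ∞ ∧ ∀ a b : ℝ, a ≤ b → ∀ σ : ℝ → X,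
    HasUnitSpeedOn σ (Icc a b) → ∫⁻ t in Icc a b, ρ (σ t) ≠ ∞ → p a b σ

namespace AlongAECurve

variable {μ : Measure X}

theorem mono {p q : ℝ → ℝ → (ℝ → X) → Prop} (hp : AlongAECurve μ p)
    (h : ∀ a b σ, a ≤ b → HasUnitSpeedOn σ (Icc a b) → p a b σ → q a b σ) : AlongAECurve μ q := by
  obtain ⟨ρ, hρ, hfin, H⟩ := hp
  exact ⟨ρ, hρ, hfin, fun a b hab σ hσ hi => h a b σ hab hσ (H a b hab σ hσ hi)⟩

theorem of_forall {p : ℝ → ℝ → (ℝ → X) → Prop}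
    (h : ∀ a b σ, a ≤ b → HasUnitSpeedOn σ (Icc a b) → p a b σ) : AlongAECurve μ p :=
  ⟨0, measurable_zero, by simp, fun a b hab σ hσ _ => h a b σ hab hσ⟩

/-- Rescaling a function of finite integral. -/
theorem exists_pos_mul_le {c : ℝ≥0∞} (hc : c ≠ ∞) {ε : ℝ≥0∞} (hε : ε ≠ 0) :
    ∃ k : ℝ≥0∞, k ≠ 0 ∧ k ≠ ∞ ∧ k * c ≤ ε := by
  obtain ⟨k, hk0, hk⟩ := ENNReal.exists_nnreal_pos_mul_lt hc hε
  exact ⟨k, by exact_mod_cast hk0.ne', ENNReal.coe_ne_top, hk.le⟩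

/-- A weighted sum of the `ρ i`, with positive weights chosen to keep its integral finite, controls
all the exceptional families at once. -/
theorem all {ι : Type*} [Countable ι] {p : ι → ℝ → ℝ → (ℝ → X) → Prop}
    (h : ∀ i, AlongAECurve μ (p i)) : AlongAECurve μ (fun a b σ => ∀ i, p i a b σ) := by
  choose ρ hρ hfin H using h
  obtain ⟨ε, hε, hsum⟩ := ENNReal.exists_pos_sum_of_countable (ε := 1) one_ne_zero ι
  have hk : ∀ i, ∃ k : ℝ≥0∞, k ≠ 0 ∧ k ≠ ∞ ∧ k * ∫⁻ x, ρ i x ∂μ ≤ ε i := fun i =>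
    exists_pos_mul_le (hfin i) (by exact_mod_cast (hε i).ne')
  choose k hk0 hkt hk using hk
  refine ⟨fun x => ∑' i, k i * ρ i x, Measurable.tsum fun i => (hρ i).const_mul _, ?_, ?_⟩
  · rw [lintegral_tsum fun i => ((hρ i).const_mul _).aemeasurable]
    refine ne_top_of_le_ne_top ENNReal.one_ne_top (le_trans (ENNReal.tsum_le_tsum fun i => ?_)
      hsum.le)
    rw [lintegral_const_mul _ (hρ i)]
    exact hk i
  · intro a b hab σ hσ hi i
    refine H i a b hab σ hσ fun htop => hi ?_
    have hle : ∫⁻ t in Icc a b, k i * ρ i (σ t) ≤ ∫⁻ t in Icc a b, ∑' i, k i * ρ i (σ t) :=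
      lintegral_mono fun t => ENNReal.le_tsum i
    rw [lintegral_const_mul' _ _ (hkt i), htop, ENNReal.mul_top (hk0 i)] at hle
    exact top_le_iff.1 hle

theorem and {p q : ℝ → ℝ → (ℝ → X) → Prop} (hp : AlongAECurve μ p) (hq : AlongAECurve μ q) :
    AlongAECurve μ (fun a b σ => p a b σ ∧ q a b σ) := by
  have h := all (μ := μ) (p := fun i : Bool => if i then p else q) (by rintro (_ | _) <;> simpa)
  exact h.mono fun a b σ _ _ H => ⟨by simpa using H true, by simpa using H false⟩

/-- Almost every curve spends zero length in a null set. -/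
theorem notMem_of_null [BorelSpace X] {N : Set X} (hN : MeasurableSet N) (h0 : μ N = 0) :
    AlongAECurve μ (fun a b σ => ∀ᵐ t ∂(volume.restrict (Icc a b)), σ t ∉ N) := by
  refine ⟨N.indicator fun _ => ∞, measurable_const.indicator hN, ?_, ?_⟩
  · rw [lintegral_indicator_const hN, h0, mul_zero]
    exact ENNReal.zero_ne_top
  · intro a b _ σ hσ hi
    have hm : AEMeasurable σ (volume.restrict (Icc a b)) :=
      (lipschitzOnWith_of_hasUnitSpeedOn hσ).continuousOn.aemeasurable measurableSet_Icc
    filter_upwards [ae_lt_top' ((measurable_const.indicator hN).comp_aemeasurable hm) hi]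
      with t ht hmem
    simp [hmem] at ht

/-- The modulus of a family of curves vanishes iff some function of finite integral has infinite
integral along every curve of the family. -/
theorem _root_.InnerPerimeter.modulus_eq_zero_iff {Γ : Set (Curve X)} :
    modulus μ Γ = 0 ↔ ∃ ρ : X → ℝ≥0∞, Measurable ρ ∧ ∫⁻ x, ρ x ∂μ ≠ ∞ ∧
      ∀ γ ∈ Γ, γ.integral ρ = ∞ := by
  constructor
  · intro h
    have hn : ∀ n : ℕ, ∃ ρ : X → ℝ≥0∞, Measurable ρ ∧ (∀ γ ∈ Γ, 1 ≤ γ.integral ρ) ∧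
        ∫⁻ x, ρ x ∂μ < 2⁻¹ ^ n := by
      intro n
      have hlt : modulus μ Γ < 2⁻¹ ^ n := by
        rw [h]
        exact pos_iff_ne_zero.2 (pow_ne_zero _ (by simp))
      unfold modulus at hlt
      simp only [iInf_lt_iff] at hlt
      obtain ⟨ρ, h1, h2, h3⟩ := hlt
      exact ⟨ρ, h1, h2, h3⟩
    choose ρ h1 h2 h3 using hn
    refine ⟨fun x => ∑' n, ρ n x, Measurable.tsum h1, ?_, ?_⟩
    · rw [lintegral_tsum fun i => (h1 i).aemeasurable]
      refine ne_top_of_le_ne_top ?_ (ENNReal.tsum_le_tsum fun i => (h3 i).le)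
      rw [ENNReal.tsum_geometric]
      simp
    · intro γ hγ
      have hN : ∀ N : ℕ, (N : ℝ≥0∞) ≤ γ.integral fun x => ∑' n, ρ n x := by
        intro N
        calc (N : ℝ≥0∞) = ∑ n ∈ Finset.range N, 1 := by simp
          _ ≤ ∑ n ∈ Finset.range N, γ.integral (ρ n) := Finset.sum_le_sum fun n _ => h2 n γ hγ
          _ ≤ ∫⁻ t in Icc 0 γ.length, ∑ n ∈ Finset.range N, ρ n (γ.arcLengthParam t) := by
              -- The lower integral is superadditive without any measurability along the curve, and
              -- only this direction is needed.
              generalize Finset.range N = s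
              classical
              induction s using Finset.induction_on with
              | empty => simp
              | insert i s hi ih =>
                simp only [Finset.sum_insert hi]
                exact (add_le_add le_rfl ih).trans (le_lintegral_add _ _)
          _ ≤ _ := lintegral_mono fun t => ENNReal.sum_le_tsum _
      by_contra hne
      obtain ⟨N, hN'⟩ := ENNReal.exists_nat_gt hne
      exact absurd (hN N) (not_le.2 hN')
  · rintro ⟨ρ, h1, h2, h3⟩
    refine le_antisymm (ENNReal.le_of_forall_pos_le_add fun ε hε _ => ?_) zero_le
    obtain ⟨k, hk0, hkt, hk⟩ := exists_pos_mul_le h2 (ε := ε) (by exact_mod_cast hε.ne')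
    rw [zero_add]
    refine le_trans (iInf_le_of_le (fun x => k * ρ x) (iInf_le_of_le (h1.const_mul _)
      (iInf_le _ ?_))) ((lintegral_const_mul _ h1).le.trans hk)
    intro γ hγ
    unfold Curve.integral
    rw [lintegral_const_mul' _ _ hkt]
    have := h3 γ hγ
    unfold Curve.integral at this
    rw [this, ENNReal.mul_top hk0]
    exact le_top

end AlongAECurve

end UnitSpeedCurves

/-! ### Weak upper gradients as derivative bounds along almost every curve -/

section PointwiseGradients

/-! ### One-dimensional calculus -/

/-- Right difference quotients of `f` are compared with those of the integral of `G`, which converge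
to `G` almost everywhere by Lebesgue differentiation. Where `f` is not differentiable, `deriv f` is
`0` and there is nothing to prove. The set `J` will be the preimage of an open set under a curve. -/
theorem ae_enorm_deriv_le_of_edist_le_lintegral {f : ℝ → ℝ} {G : ℝ → ℝ≥0∞} {a b : ℝ} (hab : a ≤ b)
    {J : Set ℝ} (hG : AEMeasurable G (volume.restrict (Icc a b)))
    (hfin : ∫⁻ t in Icc a b, G t ≠ ∞)
    (h : ∀ s t, a ≤ s → s ≤ t → t ≤ b → Icc s t ⊆ J →
      edist (f s) (f t) ≤ ∫⁻ r in Icc s t, G r) :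
    ∀ᵐ t ∂(volume.restrict (Icc a b)), J ∈ 𝓝 t → ‖deriv f t‖ₑ ≤ G t := by
  have hint : IntegrableOn (fun t => (G t).toReal) (Icc a b) :=
    integrable_toReal_of_lintegral_ne_top hG hfin
  have hii : IntervalIntegrable (fun t => (G t).toReal) volume a b :=
    (intervalIntegrable_iff_integrableOn_Icc_of_le hab).2 hint
  have hlt := ae_lt_top' hG hfin
  have hd := ae_restrict_of_ae (s := Icc a b) hii.ae_hasDerivAt_integral
  have ha : ∀ᵐ t ∂(volume.restrict (Icc a b)), t ≠ a :=
    ae_restrict_of_ae (by simp [ae_iff, measure_singleton])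
  have hb : ∀ᵐ t ∂(volume.restrict (Icc a b)), t ≠ b :=
    ae_restrict_of_ae (by simp [ae_iff, measure_singleton])
  filter_upwards [hlt, hd, ha, hb, ae_restrict_mem measurableSet_Icc] with t htlt htd hta htb ht hJ
  by_cases hdf : DifferentiableAt ℝ f t
  swap
  · rw [deriv_zero_of_not_differentiableAt hdf]
    simp
  have hF := htd (by rwa [uIcc_of_le hab]) a left_mem_uIcc
  have hs1 := (hasDerivAt_iff_tendsto_slope.1 hdf.hasDerivAt).abs
  have hs2 := hasDerivAt_iff_tendsto_slope.1 hF
  have hmono : 𝓝[>] t ≤ 𝓝[≠] t := nhdsWithin_mono _ fun x hx => ne_of_gt hx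
  have hle : |deriv f t| ≤ (G t).toReal := by
    refine le_of_tendsto_of_tendsto (hs1.mono_left hmono) (hs2.mono_left hmono) ?_
    obtain ⟨δ, hδ, hball⟩ := Metric.mem_nhds_iff.1 hJ
    have htb' : t < b := lt_of_le_of_ne ht.2 htb
    filter_upwards [Ioo_mem_nhdsGT (show t < min b (t + δ) from lt_min htb' (by linarith))]
      with x hx
    have hxb : x ≤ b := hx.2.le.trans (min_le_left _ _)
    have hsub : Icc t x ⊆ Icc a b := Icc_subset_Icc ht.1 hxb
    have hJx : Icc t x ⊆ J := fun y hy => hball (by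
      have := hx.2.trans_le (min_le_right _ _)
      rw [Metric.mem_ball, Real.dist_eq, abs_of_nonneg (by linarith [hy.1])]
      linarith [hy.2])
    have hE := h t x ht.1 hx.1.le hxb hJx
    have hne : ∫⁻ r in Icc t x, G r ≠ ∞ :=
      ne_top_of_le_ne_top hfin (lintegral_mono_set hsub)
    have hreal : |f x - f t| ≤ ∫ r in t..x, (G r).toReal := by
      rw [intervalIntegral.integral_of_le hx.1.le, ← integral_Icc_eq_integral_Ioc,
        integral_toReal (hG.mono_measure (Measure.restrict_mono hsub le_rfl))
          (ae_restrict_of_ae_restrict_of_subset hsub hlt),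
        ← Real.dist_eq, dist_comm, dist_edist]
      exact ENNReal.toReal_mono hne hE
    have hi1 : IntervalIntegrable (fun t => (G t).toReal) volume a t :=
      hii.mono_set (by rw [uIcc_of_le hab, uIcc_of_le ht.1]; exact Icc_subset_Icc le_rfl ht.2)
    have hi2 : IntervalIntegrable (fun t => (G t).toReal) volume a x :=
      hii.mono_set (by
        rw [uIcc_of_le hab, uIcc_of_le (ht.1.trans hx.1.le)]; exact Icc_subset_Icc le_rfl hxb)
    rw [slope_def_field, slope_def_field, abs_div, abs_of_pos (show 0 < x - t by linarith [hx.1]),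
      intervalIntegral.integral_interval_sub_left hi2 hi1]
    exact div_le_div_of_nonneg_right hreal (by linarith [hx.1])
  rw [Real.enorm_eq_ofReal_abs, ← ENNReal.ofReal_toReal htlt.ne]
  exact ENNReal.ofReal_le_ofReal hle

theorem edist_le_lintegral_enorm_deriv {f : ℝ → ℝ} {a b : ℝ} (hab : a ≤ b) {K : ℝ≥0}
    (hf : LipschitzOnWith K f (Icc a b)) :
    edist (f a) (f b) ≤ ∫⁻ t in Icc a b, ‖deriv f t‖ₑ := by
  rw [← uIcc_of_le hab] at hf
  rw [edist_comm, edist_eq_enorm_sub, ← hf.absolutelyContinuousOnInterval.integral_deriv_eq_sub,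
    intervalIntegral.integral_of_le hab, ← integral_Icc_eq_integral_Ioc]
  exact enorm_integral_le_lintegral_enorm _

theorem locallyLipschitzOn_comp {X Y Z : Type*} [PseudoEMetricSpace X] [PseudoEMetricSpace Y]
    [PseudoEMetricSpace Z] {f : Y → Z} {g : X → Y} {s : Set X} {t : Set Y} {K : ℝ≥0}
    (hf : LocallyLipschitzOn t f) (hg : LipschitzOnWith K g s) (h : MapsTo g s t) :
    LocallyLipschitzOn s (f ∘ g) := by
  intro x hx
  obtain ⟨C, v, hv, hC⟩ := hf (h hx)
  refine ⟨C * K, s ∩ g ⁻¹' v, ?_, ?_⟩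
  · exact inter_mem self_mem_nhdsWithin ((hg.continuousOn x hx).tendsto_nhdsWithin h hv)
  · exact hC.comp (hg.mono inter_subset_left) fun y hy => hy.2

variable {X : Type*} [MetricSpace X]

/-- A locally Lipschitz function is differentiable along almost every point of a unit-speed
curve. -/
theorem ae_differentiableAt_comp {U : Set X} (hU : IsOpen U) {u : X → ℝ}
    (hu : LocallyLipschitzOn U u) {σ : ℝ → X} {a b : ℝ} (hσ : HasUnitSpeedOn σ (Icc a b)) :
    ∀ᵐ t ∂(volume.restrict (Icc a b)), σ t ∈ U → DifferentiableAt ℝ (u ∘ σ) t := by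
  have hL := lipschitzOnWith_of_hasUnitSpeedOn hσ
  -- On a compact interval mapped into `U` the composition is Lipschitz, hence differentiable almost
  -- everywhere. Countably many rational intervals suffice to catch every interior time spent in
  -- `U`.
  have hq : ∀ q : ℚ × ℚ, ∀ᵐ t ∂(volume.restrict (Icc a b)),
      Icc (q.1 : ℝ) q.2 ⊆ Icc a b → MapsTo σ (Icc (q.1 : ℝ) q.2) U → t ∈ Ioo (q.1 : ℝ) q.2 →
        DifferentiableAt ℝ (u ∘ σ) t := by
    intro q
    by_cases h : Icc (q.1 : ℝ) q.2 ⊆ Icc a b ∧ MapsTo σ (Icc (q.1 : ℝ) q.2) U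
    · obtain ⟨K, hK⟩ := (locallyLipschitzOn_comp hu (hL.mono h.1)
        h.2).exists_lipschitzOnWith_of_compact isCompact_Icc
      refine ae_restrict_of_ae ?_
      filter_upwards [hK.ae_differentiableWithinAt_of_mem_real] with t ht _ _ htq
      exact (ht (Ioo_subset_Icc_self htq)).differentiableAt (Icc_mem_nhds htq.1 htq.2)
    · exact Eventually.of_forall fun t h1 h2 => absurd ⟨h1, h2⟩ h
  have ha : ∀ᵐ t ∂(volume.restrict (Icc a b)), t ≠ a :=
    ae_restrict_of_ae (by simp [ae_iff, measure_singleton])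
  have hb : ∀ᵐ t ∂(volume.restrict (Icc a b)), t ≠ b :=
    ae_restrict_of_ae (by simp [ae_iff, measure_singleton])
  filter_upwards [ae_all_iff.2 hq, ha, hb, ae_restrict_mem measurableSet_Icc]
    with t htq hta htb ht htU
  have hnt : Icc a b ∈ 𝓝 t := Icc_mem_nhds (lt_of_le_of_ne ht.1 hta.symm) (lt_of_le_of_ne ht.2 htb)
  have hn : Icc a b ∩ σ ⁻¹' U ∈ 𝓝 t :=
    inter_mem hnt ((hL.continuousOn.continuousAt hnt).preimage_mem_nhds (hU.mem_nhds htU))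
  obtain ⟨δ, hδ, hball⟩ := Metric.mem_nhds_iff.1 hn
  obtain ⟨p, hp1, hp2⟩ := exists_rat_btwn (show t - δ < t by linarith)
  obtain ⟨q, hq1, hq2⟩ := exists_rat_btwn (show t < t + δ by linarith)
  have hsub : Icc (p : ℝ) q ⊆ Icc a b ∩ σ ⁻¹' U := fun x hx => hball (by
    rw [Metric.mem_ball, Real.dist_eq, abs_lt]
    constructor <;> linarith [hx.1, hx.2])
  exact htq (p, q) (fun x hx => (hsub hx).1) (fun x hx => (hsub hx).2) ⟨hp2, hq1⟩

/-! ### Exhaustions by compactly contained sets -/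

/-- An increasing exhaustion of an open set by compactly contained open sets. -/
theorem exists_exhaustion [ProperSpace X] {U : Set X} (hU : IsOpen U) :
    ∃ V : ℕ → Set X, (∀ n, CompactlyContained (V n) U) ∧ (∀ n, closure (V n) ⊆ V (n + 1)) ∧
      ⋃ n, V n = U := by
  rcases isEmpty_or_nonempty X with hX | ⟨⟨o⟩⟩
  · exact ⟨fun _ => ∅, fun n => ⟨isOpen_empty, by simp, by simp⟩, by simp,
      Subsingleton.elim _ _⟩
  -- `F n` is the closed version of `V n` and lies between `closure (V n)` and `V (n + 1)`. The
  -- extended distance is `∞` when `U` is the whole space, so that case needs no separate treatment.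
  let V : ℕ → Set X := fun n => {x | dist x o < n} ∩ {x | (n : ℝ≥0∞)⁻¹ < Metric.infEDist x Uᶜ}
  let F : ℕ → Set X := fun n => {x | dist x o ≤ n} ∩ {x | (n : ℝ≥0∞)⁻¹ ≤ Metric.infEDist x Uᶜ}
  have hVo : ∀ n, IsOpen (V n) := fun n =>
    (isOpen_lt (by fun_prop) continuous_const).inter
      (isOpen_lt continuous_const Metric.continuous_infEDist)
  have hFc : ∀ n, IsClosed (F n) := fun n =>
    (isClosed_le (by fun_prop) continuous_const).inter
      (isClosed_le continuous_const Metric.continuous_infEDist)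
  have hVF : ∀ n, closure (V n) ⊆ F n := fun n =>
    closure_minimal (fun x hx => ⟨le_of_lt (show dist x o < n from hx.1),
      le_of_lt (show (n : ℝ≥0∞)⁻¹ < Metric.infEDist x Uᶜ from hx.2)⟩) (hFc n)
  have hFU : ∀ n, F n ⊆ U := fun n x hx => by
    by_contra hxU
    have h0 : Metric.infEDist x Uᶜ = 0 := Metric.infEDist_zero_of_mem hxU
    have := hx.2
    simp [h0] at this
  have hFV : ∀ n, F n ⊆ V (n + 1) := fun n x hx => by
    refine ⟨lt_of_le_of_lt (show dist x o ≤ n from hx.1) (by exact_mod_cast Nat.lt_succ_self n),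
      lt_of_lt_of_le ?_ (show (n : ℝ≥0∞)⁻¹ ≤ Metric.infEDist x Uᶜ from hx.2)⟩
    rw [ENNReal.inv_lt_inv]
    exact_mod_cast Nat.lt_succ_self n
  refine ⟨V, fun n => ⟨hVo n, ?_, (hVF n).trans (hFU n)⟩, fun n => (hVF n).trans (hFV n), ?_⟩
  · refine (isCompact_closedBall o (n : ℝ)).of_isClosed_subset isClosed_closure ?_
    exact (hVF n).trans fun x hx => hx.1
  · refine Subset.antisymm (iUnion_subset fun n => subset_closure.trans ((hVF n).trans (hFU n))) ?_
    intro x hx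
    have hpos : Metric.infEDist x Uᶜ ≠ 0 := by
      intro h0
      rw [← Metric.mem_closure_iff_infEDist_zero, hU.isClosed_compl.closure_eq] at h0
      exact h0 hx
    obtain ⟨m, hm⟩ := ENNReal.exists_inv_nat_lt hpos
    obtain ⟨k, hk⟩ := exists_nat_gt (dist x o)
    refine mem_iUnion.2 ⟨max m k, ?_, ?_⟩
    · exact hk.trans_le (by exact_mod_cast le_max_right m k)
    · refine lt_of_le_of_lt ?_ hm
      rw [ENNReal.inv_le_inv]
      exact_mod_cast le_max_left m k

theorem isLipLoc_iff [ProperSpace X] {U : Set X} (hU : IsOpen U) {u : X → ℝ} :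
    IsLipLoc U u ↔ LocallyLipschitzOn U u := by
  constructor
  · intro h x hx
    obtain ⟨V, hV, -, hVU⟩ := exists_exhaustion hU
    rw [← hVU, mem_iUnion] at hx
    obtain ⟨n, hn⟩ := hx
    obtain ⟨K, hK⟩ := h (V n) (hV n)
    exact ⟨K, V n, mem_nhdsWithin_of_mem_nhds ((hV n).1.mem_nhds hn), hK⟩
  · intro h V hV
    obtain ⟨K, hK⟩ := (h.mono hV.2.2).exists_lipschitzOnWith_of_compact hV.2.1
    exact ⟨K, hK.mono subset_closure⟩

/-! ### Pointwise gradients -/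

variable [MeasurableSpace X]

/-- Along almost every curve, the derivative of `u` is bounded by `g` at almost every time spent
in `U`. -/
def IsPointwiseGradient (μ : Measure X) (U : Set X) (u : X → ℝ) (g : X → ℝ≥0∞) : Prop :=
  AlongAECurve μ fun a b σ => ∀ᵐ t ∂(volume.restrict (Icc a b)),
    σ t ∈ U → ‖deriv (u ∘ σ) t‖ₑ ≤ g (σ t)

theorem IsPointwiseGradient.mono {μ : Measure X} {U V : Set X} {u : X → ℝ} {g : X → ℝ≥0∞}
    (h : IsPointwiseGradient μ U u g) (hVU : V ⊆ U) : IsPointwiseGradient μ V u g :=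
  AlongAECurve.mono h fun a b σ _ _ H => by
    filter_upwards [H] with t ht hV
    exact ht (hVU hV)

theorem IsPointwiseGradient.iInf {ι : Type*} [Countable ι] {μ : Measure X} {U : Set X} {u : X → ℝ}
    {g : ι → X → ℝ≥0∞} (h : ∀ i, IsPointwiseGradient μ U u (g i)) :
    IsPointwiseGradient μ U u fun x => ⨅ i, g i x :=
  (AlongAECurve.all h).mono fun a b σ _ _ H => by
    filter_upwards [ae_all_iff.2 H] with t ht hU
    exact le_iInf fun i => ht i hU

/-- Along a curve in `U` the composition is Lipschitz by compactness, so the derivative bound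
integrates to the upper gradient inequality. -/
theorem IsPointwiseGradient.isWeakUpperGradient {μ : Measure X} {U : Set X} {u : X → ℝ}
    {g : X → ℝ≥0∞} (h : IsPointwiseGradient μ U u g) (hu : LocallyLipschitzOn U u)
    (hg : AEMeasurable g (μ.restrict U)) : IsWeakUpperGradient μ U u g := by
  refine ⟨hg, modulus_eq_zero_iff.2 ?_⟩
  obtain ⟨ρ, hρ, hfin, H⟩ := h
  refine ⟨ρ, hρ, hfin, fun γ hγ => ?_⟩
  by_contra hne
  obtain ⟨hγU, hγ⟩ := hγ
  apply hγ
  have hs := γ.hasUnitSpeedOn_arcLengthParam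
  have hmaps : MapsTo γ.arcLengthParam (Icc 0 γ.length) U := fun t ht =>
    hγU (γ.arcLengthParam_mem_image ht)
  obtain ⟨K, hK⟩ := (locallyLipschitzOn_comp hu (lipschitzOnWith_of_hasUnitSpeedOn hs)
    hmaps).exists_lipschitzOnWith_of_compact isCompact_Icc
  have h1 := edist_le_lintegral_enorm_deriv γ.length_nonneg hK
  simp only [Function.comp_apply, γ.arcLengthParam_zero, γ.arcLengthParam_length] at h1
  refine h1.trans (lintegral_mono_ae ?_)
  filter_upwards [H 0 γ.length γ.length_nonneg _ hs hne, ae_restrict_mem measurableSet_Icc]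
    with t ht htm
  exact ht (hmaps htm)

/-- The inequality on all short subcurves is differentiated. Local integrability makes `g`
integrable along almost every curve within each set of an exhaustion; a Borel representative takes
the place of `g`, as almost every curve spends no time in the null set where they differ. -/
theorem IsWeakUpperGradient.isPointwiseGradient [BorelSpace X] [ProperSpace X] {μ : Measure X}
    {U : Set X} (hU : IsOpen U) {u : X → ℝ} {g : X → ℝ≥0∞} (h : IsWeakUpperGradient μ U u g)
    (hg : LocallyIntegrableIn μ U g) : IsPointwiseGradient μ U u g := by
  obtain ⟨hm, hmod⟩ := h
  obtain ⟨ρ, hρ, hfin, H⟩ := modulus_eq_zero_iff.1 hmod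
  obtain ⟨g', hg', hgg'⟩ := hm
  obtain ⟨N, hNsub, hN, hN0⟩ := exists_measurable_superset_of_null (ae_iff.1 hgg')
  have hNU0 : μ (N ∩ U) = 0 := by rwa [Measure.restrict_apply hN] at hN0
  obtain ⟨V, hV, -, hVU⟩ := exists_exhaustion hU
  have hgV : ∀ n, AlongAECurve μ fun a b σ =>
      ∫⁻ t in Icc a b, (V n).indicator g' (σ t) ≠ ∞ := fun n => by
    refine ⟨(V n).indicator g', hg'.indicator (hV n).1.measurableSet, ?_,
      fun a b _ σ _ hi => hi⟩
    rw [lintegral_indicator (hV n).1.measurableSet]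
    refine ne_top_of_le_ne_top (hg (V n) (hV n)).ne (lintegral_mono_ae ?_)
    have hsub : V n ⊆ U := subset_closure.trans (hV n).2.2
    filter_upwards [ae_restrict_of_ae_restrict_of_subset hsub hgg'] with x hx
    exact hx.ge
  -- An exceptional subcurve would force `∫ ρ = ∞` already along the whole of `σ`, so all subcurves
  -- in `U` are good simultaneously.
  have hineq : AlongAECurve μ fun a b σ => ∀ s t, a ≤ s → s ≤ t → t ≤ b → MapsTo σ (Icc s t) U →
      edist (u (σ s)) (u (σ t)) ≤ ∫⁻ r in Icc s t, g (σ r) := by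
    refine ⟨ρ, hρ, hfin, fun a b _ σ hσ hi s t has hst htb hmaps => ?_⟩
    have hσ' := hasUnitSpeedOn_mono hσ has htb
    by_contra hcon
    refine hi (top_le_iff.1 ?_)
    rw [← H (Curve.ofUnitSpeed σ s t hst hσ') ⟨?_, ?_⟩, Curve.integral_ofUnitSpeed]
    · exact lintegral_mono_set (Icc_subset_Icc has htb)
    · rintro _ ⟨r, hr, rfl⟩
      exact hmaps hr
    · unfold UpperGradientIneq
      rw [Curve.integral_ofUnitSpeed]
      exact hcon
  refine ((AlongAECurve.notMem_of_null (hN.inter hU.measurableSet) hNU0).and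
    ((AlongAECurve.all hgV).and hineq)).mono ?_
  rintro a b σ hab hσ ⟨h1, h2, h3⟩
  have hL := lipschitzOnWith_of_hasUnitSpeedOn hσ
  have hσm : AEMeasurable σ (volume.restrict (Icc a b)) :=
    hL.continuousOn.aemeasurable measurableSet_Icc
  have key : ∀ n, ∀ᵐ t ∂(volume.restrict (Icc a b)), σ ⁻¹' V n ∈ 𝓝 t →
      ‖deriv (u ∘ σ) t‖ₑ ≤ (V n).indicator g' (σ t) := fun n => by
    refine ae_enorm_deriv_le_of_edist_le_lintegral hab
      ((hg'.indicator (hV n).1.measurableSet).comp_aemeasurable hσm) (h2 n) ?_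
    intro s t has hst htb hsub
    have hVn : V n ⊆ U := subset_closure.trans (hV n).2.2
    refine (h3 s t has hst htb fun r hr => hVn (hsub hr)).trans (lintegral_mono_ae ?_)
    filter_upwards [ae_restrict_of_ae_restrict_of_subset (Icc_subset_Icc has htb) h1,
      ae_restrict_mem measurableSet_Icc] with r hr hrm
    rw [indicator_of_mem (show σ r ∈ V n from hsub hrm)]
    have : σ r ∉ N := fun hrN => hr ⟨hrN, hVn (hsub hrm)⟩
    by_contra hcon
    exact this (hNsub fun heq => hcon heq.le)
  have ha : ∀ᵐ t ∂(volume.restrict (Icc a b)), t ≠ a :=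
    ae_restrict_of_ae (by simp [ae_iff, measure_singleton])
  have hb : ∀ᵐ t ∂(volume.restrict (Icc a b)), t ≠ b :=
    ae_restrict_of_ae (by simp [ae_iff, measure_singleton])
  filter_upwards [ae_all_iff.2 key, h1, ha, hb, ae_restrict_mem measurableSet_Icc]
    with t htk htN hta htb ht htU
  have hnt : Icc a b ∈ 𝓝 t := Icc_mem_nhds (lt_of_le_of_ne ht.1 hta.symm) (lt_of_le_of_ne ht.2 htb)
  rw [← hVU, mem_iUnion] at htU
  obtain ⟨n, hn⟩ := htU
  have hVn : V n ⊆ U := subset_closure.trans (hV n).2.2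
  have hle := htk n ((hL.continuousOn.continuousAt hnt).preimage_mem_nhds ((hV n).1.mem_nhds hn))
  rw [indicator_of_mem hn] at hle
  have : σ t ∉ N := fun hrN => htN ⟨hrN, hVn hn⟩
  have heq : g (σ t) = g' (σ t) := by
    by_contra hcon
    exact this (hNsub hcon)
  rwa [heq]

end PointwiseGradients

section Energy

variable {X : Type*} [MetricSpace X] [MeasurableSpace X]

/-! ### The energy of a function in an open set -/

theorem IsPointwiseGradient.inf {μ : Measure X} {U : Set X} {u : X → ℝ} {g h : X → ℝ≥0∞}
    (hg : IsPointwiseGradient μ U u g) (hh : IsPointwiseGradient μ U u h) :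
    IsPointwiseGradient μ U u (g ⊓ h) :=
  (AlongAECurve.and hg hh).mono fun a b σ _ _ H => by
    filter_upwards [H.1, H.2] with t h1 h2 hU
    exact le_inf (h1 hU) (h2 hU)

/-- The infimum of `∫_U g dμ` over the pointwise gradients `g` of `u` in `U`. -/
def energy (μ : Measure X) (U : Set X) (u : X → ℝ) : ℝ≥0∞ :=
  ⨅ (g : X → ℝ≥0∞) (_ : AEMeasurable g (μ.restrict U)) (_ : IsPointwiseGradient μ U u g),
    ∫⁻ x in U, g x ∂μ

variable {μ : Measure X} {U V Ω : Set X} {u : X → ℝ}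

theorem energy_le {g : X → ℝ≥0∞} (hm : AEMeasurable g (μ.restrict U))
    (hg : IsPointwiseGradient μ U u g) : energy μ U u ≤ ∫⁻ x in U, g x ∂μ :=
  iInf_le_of_le g (iInf_le_of_le hm (iInf_le _ hg))

theorem exists_of_energy_lt {c : ℝ≥0∞} (h : energy μ U u < c) :
    ∃ g : X → ℝ≥0∞, AEMeasurable g (μ.restrict U) ∧ IsPointwiseGradient μ U u g ∧
      ∫⁻ x in U, g x ∂μ < c := by
  unfold energy at h
  simp only [iInf_lt_iff] at h
  obtain ⟨g, h1, h2, h3⟩ := h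
  exact ⟨g, h1, h2, h3⟩

theorem energy_mono (h : V ⊆ U) : energy μ V u ≤ energy μ U u := by
  refine le_iInf fun g => le_iInf fun hm => le_iInf fun hg => ?_
  exact (energy_le (hm.mono_measure (Measure.restrict_mono h le_rfl)) (hg.mono h)).trans
    (lintegral_mono_set h)

theorem energy_add_le [OpensMeasurableSpace X] (hV : IsOpen V) (hd : Disjoint U V) :
    energy μ U u + energy μ V u ≤ energy μ (U ∪ V) u := by
  refine le_iInf fun g => le_iInf fun hm => le_iInf fun hg => ?_
  rw [lintegral_union hV.measurableSet hd]
  exact add_le_add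
    (energy_le (hm.mono_measure (Measure.restrict_mono subset_union_left le_rfl))
      (hg.mono subset_union_left))
    (energy_le (hm.mono_measure (Measure.restrict_mono subset_union_right le_rfl))
      (hg.mono subset_union_right))

/-- The infimum `g₀` of a minimizing sequence is itself a pointwise gradient and attains the energy.
For any competitor `h`, the minimum `g₀ ⊓ h` has no smaller integral than `g₀`, so finiteness forces
`g₀ ⊓ h = g₀` almost everywhere. -/
theorem exists_isMinimalWeakUpperGradient [BorelSpace X] [ProperSpace X] (hU : IsOpen U)
    (hu : LocallyLipschitzOn U u) (hfin : energy μ U u ≠ ∞) :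
    ∃ g : X → ℝ≥0∞, IsMinimalWeakUpperGradient μ U u g ∧ ∫⁻ x in U, g x ∂μ = energy μ U u := by
  have hn : ∀ n : ℕ, ∃ g : X → ℝ≥0∞, AEMeasurable g (μ.restrict U) ∧
      IsPointwiseGradient μ U u g ∧ ∫⁻ x in U, g x ∂μ < energy μ U u + (n : ℝ≥0∞)⁻¹ := fun n =>
    exists_of_energy_lt (ENNReal.lt_add_right hfin (by simp))
  choose g hm hg hlt using hn
  let g₀ : X → ℝ≥0∞ := fun x => ⨅ n, g n x
  have hm₀ : AEMeasurable g₀ (μ.restrict U) := AEMeasurable.iInf hm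
  have hg₀ : IsPointwiseGradient μ U u g₀ := IsPointwiseGradient.iInf hg
  have hint : ∫⁻ x in U, g₀ x ∂μ = energy μ U u := by
    refine le_antisymm ?_ (energy_le hm₀ hg₀)
    have ht : Tendsto (fun n : ℕ => energy μ U u + (n : ℝ≥0∞)⁻¹) atTop (𝓝 (energy μ U u + 0)) :=
      tendsto_const_nhds.add ENNReal.tendsto_inv_nat_nhds_zero
    rw [add_zero] at ht
    exact ge_of_tendsto' ht fun n =>
      (lintegral_mono fun x => iInf_le (fun n => g n x) n).trans (hlt n).le
  refine ⟨g₀, ⟨hg₀.isWeakUpperGradient hu hm₀, fun V hV => ?_, fun h hh hloc => ?_⟩, hint⟩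
  · refine lt_of_le_of_lt (lintegral_mono_set (subset_closure.trans hV.2.2)) ?_
    rw [hint]
    exact lt_top_iff_ne_top.2 hfin
  · have hmin := energy_le (hm₀.inf hh.1) (hg₀.inf (hh.isPointwiseGradient hU hloc))
    rw [← hint] at hmin
    have hle : (g₀ ⊓ h) ≤ᵐ[μ.restrict U] g₀ := Eventually.of_forall fun x => inf_le_left
    have hae := ae_eq_of_ae_le_of_lintegral_le hle
      (ne_top_of_le_ne_top (by rwa [hint]) (lintegral_mono_ae hle)) hm₀ hmin
    filter_upwards [hae] with x hx
    rw [← hx]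
    exact inf_le_right

theorem liminf_add_liminf_le (f g : ℕ → ℝ≥0∞) :
    liminf f atTop + liminf g atTop ≤ liminf (fun i => f i + g i) atTop := by
  simp only [liminf_eq_iSup_iInf_of_nat]
  refine ENNReal.iSup_add_iSup_le fun m n => ?_
  refine le_iSup_of_le (max m n) (le_iInf₂ fun i hi => ?_)
  exact add_le_add (iInf₂_le i ((le_max_left _ _).trans hi))
    (iInf₂_le i ((le_max_right _ _).trans hi))

/-! ### The inner perimeter of open sets through the energy -/

variable [BorelSpace X] [ProperSpace X]

/-- The definition asks for a minimal gradient of every term, while existence is known only at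
finite energy; hence the passage to a subsequence whose energies stay below a number close to the
lower limit. -/
theorem innerPerimeterOpen_le_liminf_energy (hU : IsOpen U) {Ψ : ℕ → X → ℝ}
    (hΨ : IsAdmissible μ Ω U Ψ) :
    innerPerimeterOpen μ Ω U ≤ liminf (fun i => energy μ U (Ψ i)) atTop := by
  refine le_of_forall_gt fun c hc => ?_
  obtain ⟨d, hd, hdc⟩ := exists_between hc
  obtain ⟨φ, hφ, hφd⟩ := extraction_of_frequently_atTop (frequently_lt_of_liminf_lt
    (by isBoundedDefault) hd)
  have hex := fun i => exists_isMinimalWeakUpperGradient (μ := μ) hU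
    ((isLipLoc_iff hU).1 (hΨ.lipLoc (φ i))) (hφd i).ne_top
  choose g hg hgi using hex
  have hadm : IsAdmissible μ Ω U (fun i => Ψ (φ i)) :=
    ⟨fun i => hΨ.lipLoc _, fun i => hΨ.eq_zero _, hΨ.tendsto.comp hφ.tendsto_atTop⟩
  refine lt_of_le_of_lt (iInf_le_of_le _ (iInf_le_of_le g (iInf_le_of_le hadm (iInf_le _ hg)))) ?_
  refine lt_of_le_of_lt ?_ hdc
  refine (liminf_le_liminf (v := fun _ => d) (Eventually.of_forall fun i => ?_)).trans
    (by simp)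
  rw [hgi i]
  exact (hφd i).le

theorem exists_of_innerPerimeterOpen_lt (hU : IsOpen U) {c : ℝ≥0∞}
    (h : innerPerimeterOpen μ Ω U < c) {δ : ℝ≥0∞} (hδ : δ ≠ 0) :
    ∃ u : X → ℝ, LocallyLipschitzOn U u ∧ (∀ x ∈ U \ Ω, u x = 0) ∧
      ∫⁻ x in U, ‖u x - Ω.indicator (fun _ => (1 : ℝ)) x‖ₑ ∂μ ≤ δ ∧ energy μ U u < c := by
  unfold innerPerimeterOpen at h
  simp only [iInf_lt_iff] at h
  obtain ⟨Ψ, g, hΨ, hg, hlt⟩ := h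
  obtain ⟨i, hi1, hi2⟩ := ((frequently_lt_of_liminf_lt (by isBoundedDefault) hlt).and_eventually
    (hΨ.tendsto.eventually_le_const (pos_iff_ne_zero.2 hδ))).exists
  exact ⟨Ψ i, (isLipLoc_iff hU).1 (hΨ.lipLoc i), hΨ.eq_zero i, hi2,
    (energy_le (hg i).isWeakUpperGradient.1
      ((hg i).isWeakUpperGradient.isPointwiseGradient hU (hg i).locallyIntegrableIn)).trans_lt hi1⟩

theorem innerPerimeterOpen_le_of_forall (hU : IsOpen U) {c : ℝ≥0∞}
    (h : ∀ δ : ℝ≥0∞, δ ≠ 0 → ∃ u : X → ℝ, LocallyLipschitzOn U u ∧ (∀ x ∈ U \ Ω, u x = 0) ∧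
      ∫⁻ x in U, ‖u x - Ω.indicator (fun _ => (1 : ℝ)) x‖ₑ ∂μ ≤ δ ∧ energy μ U u ≤ c + δ) :
    innerPerimeterOpen μ Ω U ≤ c := by
  choose u h1 h2 h3 h4 using fun n : ℕ => h (n : ℝ≥0∞)⁻¹ (by simp)
  have hadm : IsAdmissible μ Ω U u :=
    ⟨fun i => (isLipLoc_iff hU).2 (h1 i), h2, tendsto_of_tendsto_of_tendsto_of_le_of_le
      tendsto_const_nhds ENNReal.tendsto_inv_nat_nhds_zero (fun _ => zero_le) h3⟩
  have ht : Tendsto (fun n : ℕ => c + (n : ℝ≥0∞)⁻¹) atTop (𝓝 (c + 0)) :=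
    tendsto_const_nhds.add ENNReal.tendsto_inv_nat_nhds_zero
  rw [add_zero] at ht
  rw [← ht.liminf_eq]
  exact (innerPerimeterOpen_le_liminf_energy hU hadm).trans
    (liminf_le_liminf (Eventually.of_forall h4))

theorem innerPerimeterOpen_mono (hV : IsOpen V) (hU : IsOpen U) (h : V ⊆ U) :
    innerPerimeterOpen μ Ω V ≤ innerPerimeterOpen μ Ω U := by
  refine le_of_forall_gt_imp_ge_of_dense fun c hc => ?_
  refine innerPerimeterOpen_le_of_forall hV fun δ hδ => ?_
  obtain ⟨u, h1, h2, h3, h4⟩ := exists_of_innerPerimeterOpen_lt hU hc hδ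
  exact ⟨u, h1.mono h, fun x hx => h2 x ⟨h hx.1, hx.2⟩, (lintegral_mono_set h).trans h3,
    ((energy_mono h).trans h4.le).trans le_self_add⟩

theorem innerPerimeterOpen_empty : innerPerimeterOpen μ Ω ∅ = 0 := by
  refine le_antisymm (innerPerimeterOpen_le_of_forall isOpen_empty fun δ _ => ?_) zero_le
  refine ⟨0, by simp, by simp, by simp, ?_⟩
  refine (energy_le (g := 0) aemeasurable_const ?_).trans (by simp)
  exact AlongAECurve.of_forall fun a b σ _ _ => Eventually.of_forall fun t ht => ht.elim

/-- A near-optimal sequence on the union is admissible on both pieces, and its energy splits. -/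
theorem innerPerimeterOpen_add_le (hU : IsOpen U) (hV : IsOpen V) (hd : Disjoint U V) :
    innerPerimeterOpen μ Ω U + innerPerimeterOpen μ Ω V ≤ innerPerimeterOpen μ Ω (U ∪ V) := by
  refine le_of_forall_gt_imp_ge_of_dense fun c hc => ?_
  choose u h1 h2 h3 h4 using fun n : ℕ =>
    exists_of_innerPerimeterOpen_lt (hU.union hV) hc (δ := (n : ℝ≥0∞)⁻¹) (by simp)
  have hadm : ∀ W, IsOpen W → W ⊆ U ∪ V → IsAdmissible μ Ω W u := fun W hW hsub =>
    ⟨fun i => (isLipLoc_iff hW).2 ((h1 i).mono hsub), fun i x hx => h2 i x ⟨hsub hx.1, hx.2⟩,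
      tendsto_of_tendsto_of_tendsto_of_le_of_le tendsto_const_nhds
        ENNReal.tendsto_inv_nat_nhds_zero (fun _ => zero_le)
        fun i => (lintegral_mono_set hsub).trans (h3 i)⟩
  calc innerPerimeterOpen μ Ω U + innerPerimeterOpen μ Ω V
      ≤ liminf (fun i => energy μ U (u i)) atTop + liminf (fun i => energy μ V (u i)) atTop :=
        add_le_add (innerPerimeterOpen_le_liminf_energy hU (hadm U hU subset_union_left))
          (innerPerimeterOpen_le_liminf_energy hV (hadm V hV subset_union_right))
    _ ≤ liminf (fun i => energy μ U (u i) + energy μ V (u i)) atTop := liminf_add_liminf_le _ _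
    _ ≤ liminf (fun _ : ℕ => c) atTop := liminf_le_liminf (Eventually.of_forall fun i =>
        (energy_add_le hV hd).trans (h4 i).le)
    _ = c := by simp

end Energy

section Gluing

/-! ### Locally Lipschitz functions -/

theorem locallyLipschitzOn_mul {X : Type*} [PseudoMetricSpace X] {s : Set X} {f g : X → ℝ}
    (hf : LocallyLipschitzOn s f) (hg : LocallyLipschitzOn s g) :
    LocallyLipschitzOn s fun x => f x * g x := by
  intro x hx
  obtain ⟨K, t, ht, hK⟩ := hf hx
  obtain ⟨K', t', ht', hK'⟩ := hg hx
  have hm : LocallyLipschitz fun p : ℝ × ℝ => p.1 * p.2 :=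
    (contDiff_mul (𝕜 := ℝ) (n := 1)).locallyLipschitz
  have hpair := (hK.mono (inter_subset_left (t := t'))).prodMk
    (hK'.mono (inter_subset_right (s := t)))
  have hT : t ∩ t' ∈ 𝓝[s] x := inter_mem ht ht'
  obtain ⟨C, v, hv, hC⟩ := locallyLipschitzOn_comp (hm.locallyLipschitzOn (s := univ)) hpair
    (mapsTo_univ _ _) (mem_of_mem_nhdsWithin hx hT)
  exact ⟨C, v, nhdsWithin_le_of_mem hT hv, hC⟩

theorem locallyLipschitzOn_sum {X ι : Type*} [PseudoMetricSpace X] {s : Set X} {f : ι → X → ℝ}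
    (F : Finset ι) (hf : ∀ i ∈ F, LocallyLipschitzOn s (f i)) :
    LocallyLipschitzOn s fun x => ∑ i ∈ F, f i x := by
  classical
  induction F using Finset.induction_on with
  | empty => simpa using (LocallyLipschitz.const (0 : ℝ)).locallyLipschitzOn
  | insert i F hi ih =>
    simp only [Finset.sum_insert hi]
    exact (hf i (Finset.mem_insert_self i F)).add
      (ih fun j hj => hf j (Finset.mem_insert_of_mem hj))

/-! ### Gluing along a Lipschitz partition of unity -/

variable {X : Type*} [MetricSpace X] {ι : Type*}

/-- The functions `φ i` form a partition of unity on `U` subordinate to the sets `W i`, each of them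
being Lipschitz on the whole space. -/
structure IsLipschitzPartition (U : Set X) (W : ι → Set X) (φ : ι → X → ℝ) (L : ι → ℝ≥0) :
    Prop where
  lipschitz : ∀ i, LipschitzWith (L i) (φ i)
  nonneg : ∀ i x, 0 ≤ φ i x
  le_one : ∀ i x, φ i x ≤ 1
  tsupport_subset : ∀ i, tsupport (φ i) ∩ U ⊆ W i
  locallyFinite : ∀ x ∈ U, ∃ t ∈ 𝓝 x, {i | (Function.support (φ i) ∩ t).Nonempty}.Finite
  sum_eq_one : ∀ x ∈ U, ∑ᶠ i, φ i x = 1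

variable {U Ω : Set X} {W : ι → Set X} {φ : ι → X → ℝ} {L : ι → ℝ≥0}

/-- `F` consists of the indices meeting a small neighbourhood of `x` with `x ∈ tsupport (φ i)`; the
other `φ i` vanish near `x`. Thus near `x` only functions `u i` with `x ∈ W i` enter the glued sum.
The quantifier over `v` follows that over `y`, so that `v` may be taken as the values at `y`. -/
theorem IsLipschitzPartition.exists_finset (h : IsLipschitzPartition U W φ L) (hU : IsOpen U)
    {x : X} (hx : x ∈ U) :
    ∃ F : Finset ι, (∀ i ∈ F, x ∈ W i) ∧ ∀ᶠ y in 𝓝 x, ∀ v : ι → ℝ,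
      ∑ i ∈ F, φ i y = 1 ∧ ∑ᶠ i, φ i y * v i = ∑ i ∈ F, φ i y * v i := by
  classical
  obtain ⟨t, ht, hfin⟩ := h.locallyFinite x hx
  refine ⟨hfin.toFinset.filter fun i => x ∈ tsupport (φ i), ?_, ?_⟩
  · intro i hi
    exact h.tsupport_subset i ⟨(Finset.mem_filter.1 hi).2, hx⟩
  · have hev : ∀ᶠ y in 𝓝 x, ∀ i ∈ hfin.toFinset, x ∉ tsupport (φ i) → φ i y = 0 := by
      rw [Finset.eventually_all]
      intro i _
      by_cases hi : x ∈ tsupport (φ i)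
      · exact Eventually.of_forall fun y hy => absurd hi hy
      · filter_upwards [notMem_tsupport_iff_eventuallyEq.1 hi] with y hy _
        exact hy
    filter_upwards [hev, ht, hU.mem_nhds hx] with y hy hyt hyU v
    have hzero : ∀ i, φ i y ≠ 0 → i ∈ hfin.toFinset.filter fun i => x ∈ tsupport (φ i) := by
      intro i hi
      have hmem : i ∈ hfin.toFinset := hfin.mem_toFinset.2 ⟨y, hi, hyt⟩
      refine Finset.mem_filter.2 ⟨hmem, ?_⟩
      by_contra hcon
      exact hi (hy i hmem hcon)
    constructor
    · rw [← h.sum_eq_one y hyU]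
      exact (finsum_eq_sum_of_support_subset _ fun i hi => hzero i hi).symm
    · exact finsum_eq_sum_of_support_subset _ fun i hi => hzero i (left_ne_zero_of_mul hi)

theorem IsLipschitzPartition.locallyLipschitzOn (h : IsLipschitzPartition U W φ L) (hU : IsOpen U)
    (hW : ∀ i, IsOpen (W i)) {u : ι → X → ℝ} (hu : ∀ i, LocallyLipschitzOn (W i) (u i)) :
    LocallyLipschitzOn U fun x => ∑ᶠ i, φ i x * u i x := by
  intro x hx
  obtain ⟨F, hFW, hF⟩ := h.exists_finset hU hx
  have ho : IsOpen (⋂ i ∈ F, W i) := isOpen_biInter_finset fun i _ => hW i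
  have hxo : x ∈ ⋂ i ∈ F, W i := mem_iInter₂.2 hFW
  have hs : LocallyLipschitzOn (⋂ i ∈ F, W i) fun y => ∑ i ∈ F, φ i y * u i y :=
    locallyLipschitzOn_sum F fun i hi => locallyLipschitzOn_mul
      (h.lipschitz i).locallyLipschitz.locallyLipschitzOn ((hu i).mono (biInter_subset_of_mem hi))
  obtain ⟨K, t, ht, hK⟩ := hs hxo
  rw [ho.nhdsWithin_eq hxo] at ht
  refine ⟨K, t ∩ {y | ∀ v : ι → ℝ, ∑ i ∈ F, φ i y = 1 ∧
    ∑ᶠ i, φ i y * v i = ∑ i ∈ F, φ i y * v i}, mem_nhdsWithin_of_mem_nhds (inter_mem ht hF), ?_⟩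
  intro y hy z hz
  dsimp only
  rw [(hy.2 fun i => u i y).2, (hz.2 fun i => u i z).2]
  exact hK hy.1 hz.1

/-- The weights sum to one, so the constant can be moved inside: `∑ φ i * u i - c = ∑ φ i * (u i -
c)`. -/
theorem IsLipschitzPartition.enorm_sum_sub_le (h : IsLipschitzPartition U W φ L) (hU : IsOpen U)
    (u : ι → X → ℝ) (c : ℝ) {x : X} (hx : x ∈ U) :
    ‖(∑ᶠ i, φ i x * u i x) - c‖ₑ ≤ ∑' i, (W i).indicator (fun y => ‖u i y - c‖ₑ) x := by
  obtain ⟨F, hFW, hF⟩ := h.exists_finset hU hx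
  obtain ⟨h1, h2⟩ := hF.self_of_nhds fun i => u i x
  have heq : (∑ i ∈ F, φ i x * u i x) - c = ∑ i ∈ F, φ i x * (u i x - c) := by
    simp only [mul_sub, Finset.sum_sub_distrib, ← Finset.sum_mul, h1, one_mul]
  rw [h2, heq]
  refine (enorm_sum_le _ _).trans (le_trans (Finset.sum_le_sum fun i hi => ?_)
    (ENNReal.sum_le_tsum F))
  rw [indicator_of_mem (hFW i hi), enorm_mul]
  refine mul_le_of_le_one_left zero_le ?_
  rw [Real.enorm_of_nonneg (h.nonneg i x)]
  exact ENNReal.ofReal_le_one.2 (h.le_one i x)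

/-- This is the Leibniz rule along a curve. Because the derivatives of the `φ i` sum to zero, the
number `χ (σ t)` may be subtracted from each `u i`. Only this one value enters, so `χ` needs no
regularity. -/
theorem IsLipschitzPartition.isPointwiseGradient [Countable ι] [MeasurableSpace X] {μ : Measure X}
    (h : IsLipschitzPartition U W φ L) (hU : IsOpen U) (hW : ∀ i, IsOpen (W i)) {u : ι → X → ℝ}
    (hu : ∀ i, LocallyLipschitzOn (W i) (u i)) {g : ι → X → ℝ≥0∞}
    (hg : ∀ i, IsPointwiseGradient μ (W i) (u i) (g i)) (χ : X → ℝ) :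
    IsPointwiseGradient μ U (fun x => ∑ᶠ i, φ i x * u i x) fun x =>
      ∑' i, (W i).indicator (fun y => g i y + L i * ‖u i y - χ y‖ₑ) x := by
  refine (AlongAECurve.all hg).mono fun a b σ hab hσ H => ?_
  have hL := lipschitzOnWith_of_hasUnitSpeedOn hσ
  have hdu := ae_all_iff.2 fun i => ae_differentiableAt_comp (hW i) (hu i) hσ
  have hdφ := ae_all_iff.2 fun i => ae_differentiableAt_comp isOpen_univ
    ((h.lipschitz i).locallyLipschitz.locallyLipschitzOn (s := univ)) hσ
  have ha : ∀ᵐ t ∂(volume.restrict (Icc a b)), t ≠ a :=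
    ae_restrict_of_ae (by simp [ae_iff, measure_singleton])
  have hb : ∀ᵐ t ∂(volume.restrict (Icc a b)), t ≠ b :=
    ae_restrict_of_ae (by simp [ae_iff, measure_singleton])
  filter_upwards [ae_all_iff.2 H, hdu, hdφ, ha, hb, ae_restrict_mem measurableSet_Icc]
    with t htg htu htφ hta htb ht htU
  have hnt : Icc a b ∈ 𝓝 t := Icc_mem_nhds (lt_of_le_of_ne ht.1 hta.symm) (lt_of_le_of_ne ht.2 htb)
  obtain ⟨F, hFW, hF⟩ := h.exists_finset hU htU
  have hFσ := (hL.continuousOn.continuousAt hnt).eventually hF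
  have hsum : ∑ i ∈ F, deriv (φ i ∘ σ) t = 0 := by
    have h1 : HasDerivAt (fun s => ∑ i ∈ F, (φ i ∘ σ) s) (∑ i ∈ F, deriv (φ i ∘ σ) t) t :=
      HasDerivAt.fun_sum fun i _ => (htφ i (mem_univ _)).hasDerivAt
    have h2 : (fun s => ∑ i ∈ F, (φ i ∘ σ) s) =ᶠ[𝓝 t] fun _ => 1 := by
      filter_upwards [hFσ] with s hs
      exact (hs fun _ => 0).1
    exact h1.unique ((hasDerivAt_const t (1 : ℝ)).congr_of_eventuallyEq h2)
  have hder : deriv ((fun x => ∑ᶠ i, φ i x * u i x) ∘ σ) t =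
      ∑ i ∈ F, (deriv (φ i ∘ σ) t * (u i (σ t) - χ (σ t)) + φ i (σ t) * deriv (u i ∘ σ) t) := by
    have h1 : HasDerivAt (fun s => ∑ i ∈ F, (φ i ∘ σ) s * (u i ∘ σ) s)
        (∑ i ∈ F, (deriv (φ i ∘ σ) t * (u i ∘ σ) t + (φ i ∘ σ) t * deriv (u i ∘ σ) t)) t :=
      HasDerivAt.fun_sum fun i hi =>
        (htφ i (mem_univ _)).hasDerivAt.fun_mul (htu i (hFW i hi)).hasDerivAt
    have h2 : ((fun x => ∑ᶠ i, φ i x * u i x) ∘ σ) =ᶠ[𝓝 t]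
        fun s => ∑ i ∈ F, (φ i ∘ σ) s * (u i ∘ σ) s := by
      filter_upwards [hFσ] with s hs
      exact (hs fun i => u i (σ s)).2
    rw [(h1.congr_of_eventuallyEq h2).deriv]
    simp only [mul_sub, Finset.sum_add_distrib, Finset.sum_sub_distrib, ← Finset.sum_mul, hsum,
      Function.comp_apply]
    ring
  rw [hder]
  refine (enorm_sum_le _ _).trans (le_trans (Finset.sum_le_sum fun i hi => ?_)
    (ENNReal.sum_le_tsum F))
  rw [indicator_of_mem (hFW i hi), add_comm (g i _)]
  refine (enorm_add_le _ _).trans (add_le_add ?_ ?_)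
  · rw [enorm_mul]
    gcongr
    have hlip : LipschitzOnWith (L i) (φ i ∘ σ) (Icc a b) := by
      simpa using ((h.lipschitz i).lipschitzOnWith (s := univ)).comp hL (mapsTo_univ _ _)
    have := norm_deriv_le_of_lipschitzOn hnt hlip
    exact enorm_le_coe.2 (by exact_mod_cast this)
  · rw [enorm_mul]
    refine (mul_le_of_le_one_left zero_le ?_).trans (htg i (hFW i hi))
    rw [Real.enorm_of_nonneg (h.nonneg i _)]
    exact ENNReal.ofReal_le_one.2 (h.le_one i _)

/-! ### Subadditivity over a countable Lipschitz partition of unity -/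

variable [MeasurableSpace X] [BorelSpace X] {μ : Measure X}

theorem lintegral_tsum_indicator_le [Countable ι] (U : Set X) (hW : ∀ i, IsOpen (W i))
    {f : ι → X → ℝ≥0∞} (hf : ∀ i, AEMeasurable (f i) (μ.restrict (W i))) :
    ∫⁻ x in U, ∑' i, (W i).indicator (f i) x ∂μ ≤ ∑' i, ∫⁻ x in W i, f i x ∂μ := by
  refine (setLIntegral_le_lintegral _ _).trans ?_
  rw [lintegral_tsum fun i => (aemeasurable_indicator_iff (hW i).measurableSet).2 (hf i)]
  refine ENNReal.tsum_le_tsum fun i => ?_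
  rw [lintegral_indicator (hW i).measurableSet]

theorem innerPerimeterOpen_le_tsum_of_partition [ProperSpace X] [Countable ι] (h : IsLipschitzPartition U W φ L)
    (hU : IsOpen U) (hW : ∀ i, IsOpen (W i)) (hΩ : IsOpen Ω) :
    innerPerimeterOpen μ Ω U ≤ ∑' i, innerPerimeterOpen μ Ω (W i) := by
  by_cases htop : ∑' i, innerPerimeterOpen μ Ω (W i) = ∞
  · rw [htop]
    exact le_top
  refine innerPerimeterOpen_le_of_forall hU fun δ hδ => ?_
  obtain ⟨ε, hε, hεsum⟩ := ENNReal.exists_pos_sum_of_countable (ENNReal.half_pos hδ).ne' ι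
  have hε0 : ∀ i, (ε i : ℝ≥0∞) ≠ 0 := fun i => by exact_mod_cast (hε i).ne'
  -- With `L¹` error at most `ε i / (L i + 1)`, both the error itself and its multiple by `L i` are
  -- at most `ε i`. The energy costs `ε i` more, and `∑ ε i ≤ δ / 2` pays for the two.
  choose u hu1 hu2 hu3 hu4 using fun i => exists_of_innerPerimeterOpen_lt (hW i)
    (ENNReal.lt_add_right (ENNReal.ne_top_of_tsum_ne_top htop i) (hε0 i))
    (δ := ε i / (L i + 1)) (ENNReal.div_ne_zero.2 ⟨hε0 i, by finiteness⟩)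
  choose g hg1 hg2 hg3 using fun i => exists_of_energy_lt (hu4 i)
  set χ : X → ℝ := Ω.indicator fun _ => (1 : ℝ) with hχ
  have hem : ∀ i, AEMeasurable (fun x => ‖u i x - χ x‖ₑ) (μ.restrict (W i)) := fun i =>
    (((hu1 i).continuousOn.aemeasurable (hW i).measurableSet).sub
      (measurable_const.indicator hΩ.measurableSet).aemeasurable).enorm
  have hmul : ∀ i, ((L i : ℝ≥0∞) + 1) * ∫⁻ x in W i, ‖u i x - χ x‖ₑ ∂μ ≤ ε i := fun i =>
    (mul_le_mul_right (hu3 i) _).trans ENNReal.mul_div_le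
  have hεδ : ∑' i, (ε i : ℝ≥0∞) ≤ δ / 2 := hεsum.le
  refine ⟨fun x => ∑ᶠ i, φ i x * u i x, h.locallyLipschitzOn hU hW hu1, ?_, ?_, ?_⟩
  · intro x hx
    refine finsum_eq_zero_of_forall_eq_zero fun i => ?_
    by_cases hi : φ i x = 0
    · rw [hi, zero_mul]
    · rw [hu2 i x ⟨h.tsupport_subset i ⟨subset_tsupport _ hi, hx.1⟩, hx.2⟩, mul_zero]
  · calc ∫⁻ x in U, ‖(∑ᶠ i, φ i x * u i x) - χ x‖ₑ ∂μ
        ≤ ∫⁻ x in U, ∑' i, (W i).indicator (fun y => ‖u i y - χ y‖ₑ) x ∂μ := by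
          refine setLIntegral_mono' hU.measurableSet fun x hx => ?_
          refine (h.enorm_sum_sub_le hU u (χ x) hx).trans (ENNReal.tsum_le_tsum fun i => ?_)
          by_cases hi : x ∈ W i <;> simp [hi]
      _ ≤ ∑' i, ∫⁻ x in W i, ‖u i x - χ x‖ₑ ∂μ := lintegral_tsum_indicator_le U hW hem
      _ ≤ ∑' i, (ε i : ℝ≥0∞) := ENNReal.tsum_le_tsum fun i =>
          (le_mul_of_one_le_left zero_le le_add_self).trans (hmul i)
      _ ≤ δ := hεδ.trans ENNReal.half_le_self
  · have hGm : ∀ i, AEMeasurable (fun x => g i x + L i * ‖u i x - χ x‖ₑ) (μ.restrict (W i)) :=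
      fun i => (hg1 i).add ((hem i).const_mul _)
    calc energy μ U (fun x => ∑ᶠ i, φ i x * u i x)
        ≤ ∫⁻ x in U, ∑' i, (W i).indicator (fun y => g i y + L i * ‖u i y - χ y‖ₑ) x ∂μ :=
          energy_le (AEMeasurable.tsum fun i =>
            ((aemeasurable_indicator_iff (hW i).measurableSet).2 (hGm i)).restrict)
            (h.isPointwiseGradient hU hW hu1 hg2 χ)
      _ ≤ ∑' i, ∫⁻ x in W i, (g i x + L i * ‖u i x - χ x‖ₑ) ∂μ :=
          lintegral_tsum_indicator_le U hW hGm
      _ ≤ ∑' i, (innerPerimeterOpen μ Ω (W i) + (ε i + ε i)) := by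
          refine ENNReal.tsum_le_tsum fun i => ?_
          rw [lintegral_add_left' (hg1 i), lintegral_const_mul'' _ (hem i), ← add_assoc]
          refine add_le_add (hg3 i).le (le_trans ?_ (hmul i))
          gcongr
          exact le_self_add
      _ = (∑' i, innerPerimeterOpen μ Ω (W i)) + (∑' i, (ε i : ℝ≥0∞) + ∑' i, (ε i : ℝ≥0∞)) := by
          rw [ENNReal.tsum_add, ENNReal.tsum_add]
      _ ≤ (∑' i, innerPerimeterOpen μ Ω (W i)) + δ := by
          gcongr
          exact (add_le_add hεδ hεδ).trans (ENNReal.add_halves δ).le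

end Gluing

/-! ### Lipschitz cutoff functions -/

section Cutoff

variable {X : Type*} [MetricSpace X]

/-- Two thickenings by `δ / 2` fit in `W`: one for the neighbourhood `O` of `K`, one for the decay.
Having `η = 1` on all of `O`, not just on `K`, keeps the closed supports of `1 - η` and of
differences of cutoffs away from `K`. -/
theorem exists_lipschitz_cutoff {K W : Set X} (hK : IsCompact K) (hW : IsOpen W) (hKW : K ⊆ W) :
    ∃ (η : X → ℝ) (L : ℝ≥0) (O : Set X), LipschitzWith L η ∧ (∀ x, 0 ≤ η x) ∧ (∀ x, η x ≤ 1) ∧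
      IsOpen O ∧ K ⊆ O ∧ (∀ x ∈ O, η x = 1) ∧ tsupport η ⊆ W := by
  obtain ⟨δ, hδ, hsub⟩ := hK.exists_cthickening_subset_open hW hKW
  have hδ2 : 0 < δ / 2 := half_pos hδ
  set E := Metric.thickening (δ / 2) K with hE
  refine ⟨fun x => (thickenedIndicator hδ2 E x : ℝ), (δ / 2).toNNReal⁻¹, E, ?_,
    fun x => NNReal.coe_nonneg _, fun x => by exact_mod_cast thickenedIndicator_le_one hδ2 E x,
    Metric.isOpen_thickening, Metric.self_subset_thickening hδ2 K, fun x hx => ?_, ?_⟩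
  · exact lipschitzWith_thickenedIndicator hδ2 E
  · simp [thickenedIndicator_one hδ2 E hx]
  · refine (closure_minimal (fun x hx => ?_) Metric.isClosed_cthickening).trans hsub
    by_contra hcon
    refine hx ?_
    have : x ∉ Metric.thickening (δ / 2) E := fun hmem => hcon
      (Metric.thickening_subset_cthickening δ K (by
        simpa using Metric.thickening_thickening_subset (δ / 2) (δ / 2) K hmem))
    simp [thickenedIndicator_zero hδ2 E this]

/-- Consecutive differences of cutoff functions along an exhaustion, starting at index `m`. -/
def telescopingPartition (η : ℕ → X → ℝ) (m : ℕ) : ℕ → X → ℝ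
  | 0 => η m
  | k + 1 => fun x => η (m + k + 1) x - η (m + k) x

/-- The sets in which the functions of a telescoping partition are supported. -/
def telescopingCover (V : ℕ → Set X) (m : ℕ) : ℕ → Set X
  | 0 => V (m + 1)
  | k + 1 => V (m + k + 2) \ closure (V (m + k))

/-- Each cutoff `η n` is `1` near `closure (V n)` and supported in `V (n + 1)`, where `η (n + 1)` is
`1`. So the differences are nonnegative, live in annuli, and on `V (m + n)` only those up to index
`n` survive, with sum `η (m + n) = 1`. -/
theorem exists_telescoping_partition {U : Set X} {V : ℕ → Set X} (hV : ∀ n, IsOpen (V n))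
    (hc : ∀ n, IsCompact (closure (V n))) (hs : ∀ n, closure (V n) ⊆ V (n + 1))
    (hU : ⋃ n, V n = U) (m : ℕ) :
    ∃ φ L, IsLipschitzPartition U (telescopingCover V m) φ L := by
  choose η L O hL h0 h1 hO hVO hO1 hts using fun n =>
    exists_lipschitz_cutoff (hc n) (hV (n + 1)) (hs n)
  have hmono : Monotone V := monotone_nat_of_le_succ fun n => subset_closure.trans (hs n)
  have hone : ∀ n x, x ∈ V n → η n x = 1 := fun n x hx => hO1 n x (hVO n (subset_closure hx))
  have hle : ∀ n x, η n x ≤ η (n + 1) x := fun n x => by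
    by_cases hx : η n x = 0
    · rw [hx]
      exact h0 _ _
    · rw [hone (n + 1) x (hts n (subset_tsupport _ hx))]
      exact h1 _ _
  have htel : ∀ n x, ∑ i ∈ Finset.range (n + 1), telescopingPartition η m i x = η (m + n) x := by
    intro n x
    induction n with
    | zero => simp [telescopingPartition]
    | succ n ih =>
      rw [Finset.sum_range_succ, ih]
      simp [telescopingPartition, add_assoc]
  have hvan : ∀ n x, x ∈ V (m + n) → ∀ i, n < i → telescopingPartition η m i x = 0 := by
    intro n x hx i hi
    obtain ⟨k, rfl⟩ : ∃ k, i = k + 1 := ⟨i - 1, by omega⟩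
    simp only [telescopingPartition]
    rw [hone _ x (hmono (by omega) hx), hone _ x (hmono (by omega) hx), sub_self]
  have hmem : ∀ x ∈ U, ∃ n, x ∈ V (m + n) := by
    intro x hx
    rw [← hU, mem_iUnion] at hx
    obtain ⟨n, hn⟩ := hx
    exact ⟨n, hmono (by omega) hn⟩
  refine ⟨telescopingPartition η m, fun i => Nat.casesOn i (L m)
    fun k => L (m + k + 1) + L (m + k), ?_, ?_, ?_, ?_, ?_, ?_⟩
  · rintro (_ | k)
    · exact hL m
    · exact (hL (m + k + 1)).sub (hL (m + k))
  · rintro (_ | k) x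
    · exact h0 m x
    · exact sub_nonneg.2 (hle _ x)
  · rintro (_ | k) x
    · exact h1 m x
    · exact (sub_le_self _ (h0 _ x)).trans (h1 _ x)
  · rintro (_ | k) x ⟨hx, -⟩
    · exact hts m hx
    · constructor
      · by_contra hcon
        have hx1 : x ∉ tsupport (η (m + k + 1)) := fun h => hcon (hts _ h)
        have hx0 : x ∉ tsupport (η (m + k)) := fun h => hcon (hmono (by omega) (hts _ h))
        refine notMem_tsupport_iff_eventuallyEq.2 ?_ hx
        filter_upwards [notMem_tsupport_iff_eventuallyEq.1 hx1,
          notMem_tsupport_iff_eventuallyEq.1 hx0] with y hy1 hy0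
        simp [telescopingPartition, hy1, hy0]
      · intro hcl
        refine notMem_tsupport_iff_eventuallyEq.2 ?_ hx
        filter_upwards [(hO (m + k)).mem_nhds (hVO _ hcl),
          (hV (m + k + 1)).mem_nhds (hs _ hcl)] with y hy0 hy1
        simp [telescopingPartition, hO1 _ y hy0, hone _ y hy1]
  · intro x hx
    obtain ⟨n, hn⟩ := hmem x hx
    refine ⟨V (m + n), (hV _).mem_nhds hn, (Set.finite_Iic n).subset ?_⟩
    rintro i ⟨y, hy, hyV⟩
    by_contra hcon
    exact hy (hvan n y hyV i (not_le.1 hcon))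
  · intro x hx
    obtain ⟨n, hn⟩ := hmem x hx
    rw [finsum_eq_sum_of_support_subset (s := Finset.range (n + 1)), htel, hone _ x hn]
    intro i hi
    by_contra hcon
    simp only [Finset.coe_range, mem_Iio, not_lt] at hcon
    exact hi (hvan n x hn i (by omega))

/-- A cutoff for the compact set `closure V \ B` inside `A` works together with its complement: `1 -
η` vanishes near the part of `V` outside `B`. -/
theorem exists_two_set_partition {A B V : Set X} (hA : IsOpen A) (hB : IsOpen B)
    (hc : IsCompact (closure V)) (hV : closure V ⊆ A ∪ B) :
    ∃ φ L, IsLipschitzPartition V (fun i : Bool => if i then A else B) φ L := by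
  obtain ⟨η, L, O, hL, h0, h1, hO, hKO, hO1, hts⟩ := exists_lipschitz_cutoff
    (hc.inter_right hB.isClosed_compl) hA (fun x hx => (hV hx.1).resolve_right hx.2)
  refine ⟨fun i => if i then η else fun x => 1 - η x, fun i => if i then L else 0 + L,
    ?_, ?_, ?_, ?_, fun x _ => ⟨univ, univ_mem, Set.toFinite _⟩, fun x _ => ?_⟩
  · rintro (_ | _)
    · exact (LipschitzWith.const (1 : ℝ)).sub hL
    · exact hL
  · rintro (_ | _) x
    · exact sub_nonneg.2 (h1 x)
    · exact h0 x
  · rintro (_ | _) x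
    · exact sub_le_self _ (h0 x)
    · exact h1 x
  · rintro (_ | _) x ⟨hx, hxV⟩
    · by_contra hcon
      refine notMem_tsupport_iff_eventuallyEq.2 ?_ hx
      filter_upwards [hO.mem_nhds (hKO ⟨subset_closure hxV, hcon⟩)] with y hy
      simp [hO1 y hy]
    · exact hts hx
  · rw [finsum_eq_sum_of_fintype, Fintype.sum_bool]
    simp

end Cutoff

/-! ### The inner perimeter as a set function on open sets -/

section OpenSets

theorem exists_disjoint_open_of_areSeparated {X : Type*} [MetricSpace X] {s t : Set X} (h : Metric.AreSeparated s t) :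
    ∃ S T : Set X, IsOpen S ∧ IsOpen T ∧ s ⊆ S ∧ t ⊆ T ∧ Disjoint S T := by
  obtain ⟨r, hr, hsep⟩ := h
  have hr2 : 0 < r / 2 := ENNReal.half_pos hr
  refine ⟨{x | Metric.infEDist x s < r / 2}, {x | Metric.infEDist x t < r / 2},
    isOpen_lt Metric.continuous_infEDist continuous_const,
    isOpen_lt Metric.continuous_infEDist continuous_const, fun x hx => ?_, fun x hx => ?_, ?_⟩
  · rw [mem_ofPred_eq, Metric.infEDist_zero_of_mem hx]
    exact hr2
  · rw [mem_ofPred_eq, Metric.infEDist_zero_of_mem hx]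
    exact hr2
  · refine Set.disjoint_left.2 fun x hxs hxt => ?_
    obtain ⟨y, hy, hxy⟩ := Metric.infEDist_lt_iff.1 hxs
    obtain ⟨z, hz, hxz⟩ := Metric.infEDist_lt_iff.1 hxt
    have : edist y z < r := by
      calc edist y z ≤ edist x y + edist x z := edist_triangle_left y z x
        _ < r / 2 + r / 2 := ENNReal.add_lt_add hxy hxz
        _ = r := ENNReal.add_halves r
    exact absurd (hsep y hy z hz) (not_le.2 this)

/-! ### Approximation from inside and countable subadditivity -/

variable {X : Type*} [MetricSpace X] [MeasurableSpace X] [BorelSpace X] [ProperSpace X]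
  {μ : Measure X} {Ω : Set X}

/-- Gluing over `V (m + 1)` and the annuli `C k`, `k ≥ m`, bounds the left side by `l` plus a tail
of `∑ P₊(Ω, C k)`. If `l` is finite this series converges, so the tail tends to zero as `m` grows.
-/
theorem innerPerimeterOpen_le_iSup (hΩ : IsOpen Ω) {U : Set X} {V : ℕ → Set X}
    (hV : ∀ n, IsOpen (V n)) (hc : ∀ n, IsCompact (closure (V n)))
    (hs : ∀ n, closure (V n) ⊆ V (n + 1)) (hU : ⋃ n, V n = U) :
    innerPerimeterOpen μ Ω U ≤ ⨆ n, innerPerimeterOpen μ Ω (V n) := by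
  set l := ⨆ n, innerPerimeterOpen μ Ω (V n) with hl
  have hle : ∀ n, innerPerimeterOpen μ Ω (V n) ≤ l := le_iSup fun n => innerPerimeterOpen μ Ω (V n)
  by_cases htop : l = ∞
  · rw [htop]
    exact le_top
  let C : ℕ → Set X := fun n => V (n + 2) \ closure (V n)
  have hC : ∀ n, IsOpen (C n) := fun n => (hV _).sdiff isClosed_closure
  have hmono : Monotone V := monotone_nat_of_le_succ fun n => subset_closure.trans (hs n)
  -- Annuli of equal parity are disjoint, hence two terms on the right. In the induction, `C n` is
  -- absorbed with the disjoint set `V n` into `V (n + 2)`.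
  have hsum : ∀ n, ∑ k ∈ Finset.range n, innerPerimeterOpen μ Ω (C k) ≤
      innerPerimeterOpen μ Ω (V n) + innerPerimeterOpen μ Ω (V (n + 1)) := by
    intro n
    induction n with
    | zero => simp
    | succ n ih =>
      have hd : Disjoint (V n) (C n) :=
        (disjoint_sdiff_right (s := closure (V n)) (t := V (n + 2))).mono_left subset_closure
      have hsub : V n ∪ C n ⊆ V (n + 2) := union_subset (hmono (by omega)) sdiff_subset
      rw [Finset.sum_range_succ]
      calc _ ≤ innerPerimeterOpen μ Ω (V n) + innerPerimeterOpen μ Ω (V (n + 1)) +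
            innerPerimeterOpen μ Ω (C n) := by gcongr
        _ = innerPerimeterOpen μ Ω (V (n + 1)) +
            (innerPerimeterOpen μ Ω (V n) + innerPerimeterOpen μ Ω (C n)) := by ring
        _ ≤ _ := by
            gcongr
            exact (innerPerimeterOpen_add_le (hV n) (hC n) hd).trans
              (innerPerimeterOpen_mono ((hV n).union (hC n)) (hV _) hsub)
  have htsum : ∑' k, innerPerimeterOpen μ Ω (C k) ≠ ∞ := by
    refine ne_top_of_le_ne_top (ENNReal.add_ne_top.2 ⟨htop, htop⟩)
      (ENNReal.tsum_le_of_sum_range_le fun n => (hsum n).trans (add_le_add (hle _) (hle _)))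
  have ht : Tendsto (fun m => l + ∑' k, innerPerimeterOpen μ Ω (C (k + m))) atTop (𝓝 (l + 0)) :=
    tendsto_const_nhds.add (ENNReal.tendsto_sum_nat_add _ htsum)
  rw [add_zero] at ht
  refine ge_of_tendsto' ht fun m => ?_
  obtain ⟨φ, L, hφ⟩ := exists_telescoping_partition hV hc hs hU m
  have hUo : IsOpen U := hU ▸ isOpen_iUnion hV
  refine (innerPerimeterOpen_le_tsum_of_partition hφ hUo ?_ hΩ).trans ?_
  · rintro (_ | k)
    · exact hV _
    · exact hC _
  · rw [tsum_eq_zero_add' ENNReal.summable]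
    refine add_le_add (hle _) (le_of_eq (tsum_congr fun k => ?_))
    simp only [telescopingCover, C, add_comm m k]

theorem exists_compactlyContained_lt (hΩ : IsOpen Ω) {U : Set X} (hU : IsOpen U) {c : ℝ≥0∞}
    (h : c < innerPerimeterOpen μ Ω U) :
    ∃ V, CompactlyContained V U ∧ c < innerPerimeterOpen μ Ω V := by
  obtain ⟨V, hV, hs, hVU⟩ := exists_exhaustion hU
  obtain ⟨n, hn⟩ := lt_iSup_iff.1 (h.trans_le (innerPerimeterOpen_le_iSup hΩ
    (fun n => (hV n).1) (fun n => (hV n).2.1) hs hVU))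
  exact ⟨V n, hV n, hn⟩

/-- A Lipschitz partition subordinate to `A`, `B` is available only on compactly contained sets, and
these suffice by approximation from inside. -/
theorem innerPerimeterOpen_union_le (hΩ : IsOpen Ω) {A B : Set X} (hA : IsOpen A) (hB : IsOpen B) :
    innerPerimeterOpen μ Ω (A ∪ B) ≤ innerPerimeterOpen μ Ω A + innerPerimeterOpen μ Ω B := by
  refine le_of_forall_lt_imp_le_of_dense fun c hc => ?_
  obtain ⟨V, hV, hcV⟩ := exists_compactlyContained_lt hΩ (hA.union hB) hc
  obtain ⟨φ, L, hφ⟩ := exists_two_set_partition hA hB hV.2.1 hV.2.2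
  refine hcV.le.trans ((innerPerimeterOpen_le_tsum_of_partition hφ hV.1 ?_ hΩ).trans ?_)
  · rintro (_ | _)
    · exact hB
    · exact hA
  · rw [tsum_fintype, Fintype.sum_bool]
    simp

theorem innerPerimeterOpen_biUnion_finset_le (hΩ : IsOpen Ω) {ι : Type*} {A : ι → Set X}
    (hA : ∀ i, IsOpen (A i)) (F : Finset ι) :
    innerPerimeterOpen μ Ω (⋃ i ∈ F, A i) ≤ ∑ i ∈ F, innerPerimeterOpen μ Ω (A i) := by
  classical
  induction F using Finset.induction_on with
  | empty => simp [innerPerimeterOpen_empty]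
  | insert i F hi ih =>
    rw [Finset.set_biUnion_insert, Finset.sum_insert hi]
    exact (innerPerimeterOpen_union_le hΩ (hA i) (isOpen_biUnion fun j _ => hA j)).trans
      (add_le_add le_rfl ih)

theorem innerPerimeterOpen_iUnion_le (hΩ : IsOpen Ω) {A : ℕ → Set X} (hA : ∀ i, IsOpen (A i)) :
    innerPerimeterOpen μ Ω (⋃ i, A i) ≤ ∑' i, innerPerimeterOpen μ Ω (A i) := by
  refine le_of_forall_lt_imp_le_of_dense fun c hc => ?_
  obtain ⟨V, hV, hcV⟩ := exists_compactlyContained_lt hΩ (isOpen_iUnion hA) hc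
  obtain ⟨F, hF⟩ := hV.2.1.elim_finite_subcover A hA hV.2.2
  calc c ≤ innerPerimeterOpen μ Ω V := hcV.le
    _ ≤ innerPerimeterOpen μ Ω (⋃ i ∈ F, A i) := innerPerimeterOpen_mono hV.1
        (isOpen_biUnion fun j _ => hA j) (subset_closure.trans hF)
    _ ≤ ∑ i ∈ F, innerPerimeterOpen μ Ω (A i) := innerPerimeterOpen_biUnion_finset_le hΩ hA F
    _ ≤ _ := ENNReal.sum_le_tsum F

/-! ### The inner perimeter as an outer measure -/

theorem innerPerimeter_of_isOpen {U : Set X} (hU : IsOpen U) :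
    innerPerimeter μ Ω U = innerPerimeterOpen μ Ω U :=
  le_antisymm (iInf_le_of_le U (iInf_le_of_le hU (iInf_le _ Subset.rfl)))
    (le_iInf fun _ => le_iInf fun hV => le_iInf fun hUV => innerPerimeterOpen_mono hU hV hUV)

theorem exists_outerMeasure_eq_innerPerimeter (hΩ : IsOpen Ω) :
    ∃ ν : OuterMeasure X, ∀ A, ν A = innerPerimeter μ Ω A :=
  ⟨inducedOuterMeasure (fun U (_ : IsOpen U) => innerPerimeterOpen μ Ω U) isOpen_empty
    innerPerimeterOpen_empty, fun A => inducedOuterMeasure_eq_iInf (fun _ h => isOpen_iUnion h)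
      (fun _ h => innerPerimeterOpen_iUnion_le hΩ h)
      (fun _ _ h h' hsub => innerPerimeterOpen_mono h h' hsub) A⟩

/-- Separated sets have disjoint open neighbourhoods; cutting an open competitor for the union with
them reduces the claim to superadditivity on open sets. -/
theorem isMetric_of_eq_innerPerimeter {ν : OuterMeasure X}
    (hν : ∀ A, ν A = innerPerimeter μ Ω A) : ν.IsMetric := by
  intro s t hst
  refine le_antisymm (measure_union_le s t) ?_
  obtain ⟨S, T, hS, hT, hsS, htT, hd⟩ := exists_disjoint_open_of_areSeparated hst
  rw [hν (s ∪ t)]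
  refine le_iInf fun W => le_iInf fun hW => le_iInf fun hsub => ?_
  calc ν s + ν t ≤ ν (W ∩ S) + ν (W ∩ T) := add_le_add
        (measure_mono (subset_inter (subset_union_left.trans hsub) hsS))
        (measure_mono (subset_inter (subset_union_right.trans hsub) htT))
    _ = innerPerimeterOpen μ Ω (W ∩ S) + innerPerimeterOpen μ Ω (W ∩ T) := by
        rw [hν, hν, innerPerimeter_of_isOpen (hW.inter hS), innerPerimeter_of_isOpen (hW.inter hT)]
    _ ≤ innerPerimeterOpen μ Ω (W ∩ S ∪ W ∩ T) := innerPerimeterOpen_add_le (hW.inter hS)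
        (hW.inter hT) (hd.mono inter_subset_right inter_subset_right)
    _ ≤ innerPerimeterOpen μ Ω W := innerPerimeterOpen_mono ((hW.inter hS).union (hW.inter hT)) hW
        (union_subset inter_subset_left inter_subset_left)

theorem isRadon_of_eq_innerPerimeter (hΩ : IsOpen Ω) {ν : OuterMeasure X}
    (hν : ∀ A, ν A = innerPerimeter μ Ω A) (hfin : innerPerimeter μ Ω univ < ∞) : IsRadon ν := by
  have hopen : ∀ U, IsOpen U → ν U = innerPerimeterOpen μ Ω U := fun U hU => by
    rw [hν, innerPerimeter_of_isOpen hU]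
  have hlt : ∀ A, ν A < ∞ := fun A => (measure_mono (subset_univ A)).trans_lt (by rwa [hν])
  have houter : ∀ A, ν A = ⨅ (U : Set X) (_ : IsOpen U) (_ : A ⊆ U), ν U := fun A => by
    rw [hν]
    exact iInf_congr fun U => iInf_congr fun hU => by rw [hopen U hU]
  refine ⟨⟨(isMetric_of_eq_innerPerimeter hν).borel_le_caratheodory, fun A => ?_⟩,
    fun K _ => hlt K, houter, fun U hU => le_antisymm ?_ ?_⟩
  -- The Borel hull is a countable intersection of near-optimal open supersets; finiteness of `ν A`
  -- makes the strict inequality possible.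
  · have hex : ∀ n : ℕ, ∃ U, IsOpen U ∧ A ⊆ U ∧ ν U < ν A + (n : ℝ≥0∞)⁻¹ := fun n => by
      have h : ν A < ν A + (n : ℝ≥0∞)⁻¹ := ENNReal.lt_add_right (hlt A).ne (by simp)
      conv_lhs at h => rw [houter A]
      simp only [iInf_lt_iff] at h
      obtain ⟨U, h1, h2, h3⟩ := h
      exact ⟨U, h1, h2, h3⟩
    choose U hU hAU hUlt using hex
    refine ⟨⋂ n, U n, ?_, subset_iInter hAU, le_antisymm ?_ (measure_mono (subset_iInter hAU))⟩
    · borelize X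
      exact MeasurableSet.iInter fun n => (hU n).measurableSet
    · have ht : Tendsto (fun n : ℕ => ν A + (n : ℝ≥0∞)⁻¹) atTop (𝓝 (ν A + 0)) :=
        tendsto_const_nhds.add ENNReal.tendsto_inv_nat_nhds_zero
      rw [add_zero] at ht
      exact ge_of_tendsto' ht fun n => (measure_mono (iInter_subset U n)).trans (hUlt n).le
  · rw [hopen U hU]
    refine le_of_forall_lt_imp_le_of_dense fun c hc => ?_
    obtain ⟨V, hV, hcV⟩ := exists_compactlyContained_lt hΩ hU hc
    refine hcV.le.trans (le_iSup_of_le (closure V) (le_iSup_of_le hV.2.1 (le_iSup_of_le hV.2.2 ?_)))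
    rw [← hopen V hV.1]
    exact measure_mono subset_closure
  · exact iSup_le fun K => iSup_le fun _ => iSup_le fun hKU => measure_mono hKU

end OpenSets

/-! ### Complete doubling spaces are proper -/

/-- By iterated doubling, small balls centred in a bounded set have measure bounded below, so only
finitely many disjoint ones fit in a ball of finite measure. Closed balls are thus totally bounded,
and completeness makes them compact. -/
theorem IsDoubling.properSpace {X : Type*} [MetricSpace X] [CompleteSpace X] [MeasurableSpace X]
    [BorelSpace X] {μ : Measure X} (h : IsDoubling μ) : ProperSpace X := by
  obtain ⟨C, hC1, hC⟩ := h
  have hpos : ∀ (x : X) (r : ℝ), 0 < r → μ (Metric.ball x r) ≠ 0 := fun x r hr => by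
    have := (hC x (r / 2) (half_pos hr)).1
    rw [mul_div_cancel₀ r two_ne_zero] at this
    exact this.ne'
  have hpow : ∀ (k : ℕ) (x : X) (r : ℝ), 0 < r →
      μ (Metric.ball x (2 ^ k * r)) ≤ C ^ k * μ (Metric.ball x r) := by
    intro k x r hr
    induction k with
    | zero => simp
    | succ k ih =>
      calc μ (Metric.ball x (2 ^ (k + 1) * r)) = μ (Metric.ball x (2 * (2 ^ k * r))) := by
            congr 2
            ring
        _ ≤ C * μ (Metric.ball x (2 ^ k * r)) := (hC x _ (by positivity)).2.1
        _ ≤ C * (C ^ k * μ (Metric.ball x r)) := by gcongr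
        _ = _ := by ring
  have hC0 : (C : ℝ≥0∞) ≠ 0 := by
    have : C ≠ 0 := (zero_lt_one.trans_le hC1).ne'
    exact_mod_cast this
  refine ⟨fun x R => isCompact_iff_totallyBounded_isComplete.2
    ⟨?_, Metric.isClosed_closedBall.isComplete⟩⟩
  refine Metric.totallyBounded_iff.2 fun ε hε => ?_
  -- All radii being `ε / 10`, the fivefold enlargements have radius `ε / 2 < ε`, so the centres
  -- form a finite `ε`-net once the family is finite.
  obtain ⟨u, hu, hdisj, hcov⟩ := Vitali.exists_disjoint_subfamily_covering_enlargement_closedBall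
    (Metric.closedBall x R) id (fun _ => ε / 10) (ε / 10) (fun _ _ => le_rfl) 5 (by norm_num)
  refine ⟨u, ?_, fun y hy => ?_⟩
  · rcases lt_or_ge R 0 with hR | hR
    · rw [Metric.closedBall_eq_empty.2 hR, subset_empty_iff] at hu
      rw [hu]
      exact finite_empty
    -- `B(x, S)` contains all the small balls, and `B(x, S) ⊆ B(y, 2 * S)` for every centre `y`; `k`
    -- counts the doublings from `ε / 10` to at least `2 * S`.
    set S := R + ε with hS
    have hS0 : 0 < S := by positivity
    obtain ⟨k, hk⟩ := pow_unbounded_of_one_lt (2 * S / (ε / 10)) (one_lt_two (α := ℝ))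
    have hk' : 2 * S ≤ 2 ^ k * (ε / 10) := ((div_lt_iff₀ (by positivity)).1 hk).le
    have hlow : ∀ y ∈ u, μ (Metric.ball x S) / C ^ k ≤ μ (Metric.closedBall y (ε / 10)) := by
      intro y hy
      refine ENNReal.div_le_of_le_mul' ?_
      calc μ (Metric.ball x S) ≤ μ (Metric.ball y (2 ^ k * (ε / 10))) := by
            refine measure_mono (Metric.ball_subset_ball' ?_)
            have := hu hy
            rw [Metric.mem_closedBall, dist_comm] at this
            linarith
        _ ≤ C ^ k * μ (Metric.ball y (ε / 10)) := hpow k y _ (by positivity)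
        _ ≤ _ := by
            gcongr
            exact Metric.ball_subset_closedBall
    have hfin := Measure.finite_const_le_meas_of_disjoint_iUnion μ (ι := u)
      (ε := μ (Metric.ball x S) / C ^ k)
      (As := fun y => Metric.closedBall (y : X) (ε / 10))
      (ENNReal.div_pos (hpos x S hS0) (by finiteness))
      (fun y => Metric.isClosed_closedBall.measurableSet)
      (fun y z hyz => hdisj y.2 z.2 fun heq => hyz (Subtype.ext heq)) (by
        refine ne_top_of_le_ne_top (hC x S hS0).2.2.ne (measure_mono (iUnion_subset fun y => ?_))
        intro z hz
        have h1 := hu y.2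
        rw [Metric.mem_closedBall] at h1 hz
        rw [Metric.mem_ball]
        linarith [dist_triangle z y x])
    have huniv : (univ : Set u).Finite := hfin.subset fun y _ => hlow y y.2
    exact Set.finite_coe_iff.1 (Set.finite_univ_iff.1 huniv)
  · obtain ⟨b, hb, hsub⟩ := hcov y hy
    refine mem_iUnion₂.2 ⟨b, hb, ?_⟩
    have := hsub (Metric.mem_closedBall_self (by positivity))
    simp only [id, Metric.mem_closedBall] at this
    rw [Metric.mem_ball]
    linarith

end InnerPerimeter

end

/-! ### The inner perimeter is a Radon measure -/

theorem mainTheorem8 {X : Type*} [MetricSpace X] [CompleteSpace X] [Nontrivial X]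
    [MeasurableSpace X] [BorelSpace X] (μ : Measure X)
    (hdoubling : InnerPerimeter.IsDoubling μ) (hpoincare : InnerPerimeter.SupportsPoincare μ)
    (Ω : Set X) (hΩ : IsOpen Ω) (hfin : InnerPerimeter.innerPerimeter μ Ω univ < ∞) :
    ∃ ν : OuterMeasure X,
      (∀ A : Set X, ν A = InnerPerimeter.innerPerimeter μ Ω A) ∧
      InnerPerimeter.IsBorelRegular ν ∧ InnerPerimeter.IsRadon ν := by
  have := hdoubling.properSpace
  obtain ⟨ν, hν⟩ := InnerPerimeter.exists_outerMeasure_eq_innerPerimeter (μ := μ) hΩ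
  have hR := InnerPerimeter.isRadon_of_eq_innerPerimeter hΩ hν hfin
  exact ⟨ν, hν, hR.toIsBorelRegular, hR⟩
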